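/- Let $c,c_2>0$ and $0<T<T^*$, and put $\lambda=T^*/T-1$, $k=c_2/(c\lambda)$. For $a>0$ let $f^a_t(x)=\mathbf 1_{\{x>0\}}\,\frac{at}{\sqrt{2\pi}\,x^{3/2}}\exp\bigl(-\tfrac{a^2t^2}{2x}\bigr)$, and let a stable-1/2 subordinator with activity parameter $a$ be an increasing Lévy process $\{S_t\}$ such that $S_t$ has density $f^a_t$ for $t>0$. A càdlàg process $\{\xi_{tT}\}_{0\le t\le T}$ starting at $0$ is a stable-1/2 random bridge with activity parameter $a$ and terminal density $q$ on $(0,\infty)$ if $\xi_{TT}$ has density $q$ and, for some stable-1/2 subordinator $\{S_t\}$ with activity parameter $a$, for all $0<t_1<\dots<t_n<T$ and $(x_1,\dots,x_n)\in\mathbb R^n$, $$\mathbb Q[\xi_{t_1T}\le x_1,\dots,\xi_{t_nT}\le x_n\mid \xi_{TT}=z]=\mathbb Q[S_{t_1}\le x_1,\dots,S_{t_n}\le x_n\mid S_T=z]$$ for $q(z)\,dz$-almost every $z$. Put $f^a_{tT}(y;z)=f^a_t(y)f^a_{T-t}(z-y)/f^a_T(z)$. Let $\{S(t,T^*)\}_{0\le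 t\le T^*}$ be a stable-1/2 random bridge with activity parameter $c$ and terminal density $p$ on $(0,\infty)$, and for $0\le t\le T$ define $$\xi^{(1)}_{tT}=S(t,T^*),\qquad \xi^{(2)}_{tT}=k^2S(\lambda t+T,T^*)-k^2S(T,T^*).$$ (i) $\{\xi^{(1)}_{tT}\}$ is a stable-1/2 random bridge with activity parameter $c$ and terminal density $p^{(1)}(x)=\int_0^\infty f^c_{T,T^*}(x;z)\,p(z)\,dz$. (ii) $\{\xi^{(2)}_{tT}\}$ is a stable-1/2 random bridge with activity parameter $c_2$ and terminal density $p^{(2)}(x)=k^{-2}\int_0^\infty f^{c_2}_{T,\lambda^{-1}T^*}(x;z)\,p(k^{-2}z)\,dz$. (iii) Suppose $\mathbb E[S(T^*,T^*)]<\infty$. Then $\xi^{(1)}_{TT},\xi^{(2)}_{TT}$ are integrable. Let $0\le t<T$, let $\mathcal F_t$ be generated by $\{(\xi^{(1)}_{sT},\xi^{(2)}_{sT})\}_{0\le s\le t}$, and put $U^{(i)}_{tT}(x_1,x_2)=\mathbb E[\xi^{(i)}_{TT}\mid\xi^{(1)}_{tT}=x_1,\xi^{(2)}_{tT}=x_2]$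 and $M_t(y)=\mathbb E[S(T^*,T^*)\mid S((1+\lambda)t,T^*)=y]$. Then $\mathbb E[\xi^{(i)}_{TT}\mid\mathcal F_t]=U^{(i)}_{tT}(\xi^{(1)}_{tT},\xi^{(2)}_{tT})$ almost surely for $i=1,2$, and for almost every value $(x_1,x_2)$ of $(\xi^{(1)}_{tT},\xi^{(2)}_{tT})$, with $y=x_1+k^{-2}x_2$, $$U^{(1)}_{tT}(x_1,x_2)=\frac{T-t}{T^*-(1+\lambda)t}\bigl(M_t(y)-k^{-2}x_2\bigr)+\frac{T^*-(T+\lambda t)}{T^*-(1+\lambda)t}\,x_1,$$ $$U^{(2)}_{tT}(x_1,x_2)=k^2\,\frac{T^*-(T+\lambda t)}{T^*-(1+\lambda)t}\bigl(M_t(y)-x_1\bigr)+\frac{T-t}{T^*-(1+\lambda)t}\,x_2,$$ $$M_t(y)=\int_0^\infty z\,p_t(z)\,dz,\qquad p_t(z)=\mathbf 1_{\{z>y\}}K^{-1}\Bigl(\frac{z}{z-y}\Bigr)^{3/2}\exp\Bigl(-\frac{c^2}{2}\Bigl(\frac{(T^*-(1+\lambda)t)^2}{z-y}-\frac{T^{*2}}{z}\Bigr)\Bigr)p(z),$$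 where $K$ (depending on $t$ and $y$) is the constant for which $p_t$ is a probability density on $(0,\infty)$, and the integral defining $M_t(y)$ converges. -/

import Mathlib

open MeasureTheory ProbabilityTheory Filter Topology Set
open scoped NNReal ENNReal

/-- The density `f_t(x)` at time `t` of the stable-1/2 subordinator with activity parameter `c`
(a Lévy distribution). -/
noncomputable def stableHalfDensity (c t x : ℝ) : ℝ :=
  if 0 < x then
    c * t / (Real.sqrt (2 * Real.pi) * x ^ (3 / 2 : ℝ)) * Real.exp (-(1 / 2) * (c ^ 2 * t ^ 2 / x))
  else 0

/-- The density `f_{tT}(y; z) = f_t(y) f_{T-t}(z-y) / f_T(z)`, at time `t`, of the stable-1/2 bridge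
with activity parameter `c` to the value `z` at time `T`. -/
noncomputable def stableHalfBridgeDensity (c t T y z : ℝ) : ℝ :=
  stableHalfDensity c t y * stableHalfDensity c (T - t) (z - y) / stableHalfDensity c T z

/-- A stable-1/2 subordinator with activity parameter `c`: a Lévy process with càdlàg,
nondecreasing paths (left limits are then automatic) whose increments over intervals of length `h`
have density `f_h`. -/
structure IsStableHalfSubordinator {Ω : Type*} [MeasurableSpace Ω] (c : ℝ) (S : ℝ≥0 → Ω → ℝ)
    (P : Measure Ω) : Prop where
  measurable : ∀ t, Measurable (S t)
  start : ∀ ω, S 0 ω = 0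
  mono : ∀ ω, Monotone fun t => S t ω
  rightCts : ∀ ω t, ContinuousWithinAt (fun s => S s ω) (Ici t) t
  indep : HasIndepIncrements S P
  law : ∀ s t : ℝ≥0, s < t → P.map (fun ω => S t ω - S s ω) =
    volume.withDensity fun x => ENNReal.ofReal (stableHalfDensity c (t - s) x)

/-- The measure on `(0, ∞)` with density `p` (only the values of `p` on `(0, ∞)` matter). -/
noncomputable def lawOfDensity (p : ℝ → ℝ) : Measure ℝ :=
  (volume.restrict (Ioi 0)).withDensity fun z => ENNReal.ofReal (p z)

/-- `ξ`, considered on `[0, T]`, is a stable-1/2 random bridge with terminal density `p` and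
activity parameter `c`: its terminal value has density `p` on `(0, ∞)` and, for some stable-1/2
subordinator `S` with activity parameter `c`, the conditional finite-dimensional distribution
functions of `ξ` given `ξ_T = z` are those of `S` given `S_T = z`, for almost every `z` under the
terminal law. (The law of `S_T` is equivalent to Lebesgue measure on `(0, ∞)`, so the conditional
law given `S_T = z` is determined for almost every `z` under the terminal law.)
Processes start at `0` and have càdlàg paths. -/
structure IsStableHalfRandomBridge {Ω : Type*} [MeasurableSpace Ω] (c T : ℝ) (p : ℝ → ℝ)
    (ξ : ℝ → Ω → ℝ) (P : Measure Ω) [IsProbabilityMeasure P] : Prop where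
  measurable : ∀ t ∈ Icc 0 T, Measurable (ξ t)
  start : ∀ᵐ ω ∂P, ξ 0 ω = 0
  rightCts : ∀ ω, ∀ t ∈ Ico 0 T, ContinuousWithinAt (fun s => ξ s ω) (Ici t) t
  leftLim : ∀ ω, ∀ t ∈ Ioc 0 T, ∃ l : ℝ, Tendsto (fun s => ξ s ω) (𝓝[<] t) (𝓝 l)
  density_measurable : Measurable p
  density_nonneg : ∀ z, 0 < z → 0 ≤ p z
  terminal_law : P.map (ξ T) = lawOfDensity p
  bridge_law : ∃ (Ω' : Type) (_ : MeasurableSpace Ω') (P' : Measure Ω')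
    (_ : IsProbabilityMeasure P') (S : ℝ≥0 → Ω' → ℝ), IsStableHalfSubordinator c S P' ∧
      ∀ (n : ℕ) (t : Fin n → ℝ), StrictMono t → (∀ i, t i ∈ Ioo 0 T) →
        ∀ x : Fin n → ℝ, ∀ᵐ z ∂(lawOfDensity p),
          condDistrib (fun ω i => ξ (t i) ω) (ξ T) P z {y | ∀ i, y i ≤ x i} =
          condDistrib (fun ω i => S (t i).toNNReal ω) (S T.toNNReal) P' z {y | ∀ i, y i ≤ x i}

/-- The conditional mean `E[Y | X = x]`, computed with the regular conditional distribution of `Y`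
given `X`. -/
noncomputable def condMeanGiven {Ω E : Type*} [MeasurableSpace Ω] [MeasurableSpace E]
    (Y : Ω → ℝ) (X : Ω → E) (P : Measure Ω) [IsProbabilityMeasure P] (x : E) : ℝ :=
  ∫ y, y ∂(condDistrib Y X P x)

/-- The σ-algebra generated by the processes `ξ₁` and `ξ₂` up to time `t`. -/
@[reducible] def jointHistory {Ω : Type*} (ξ₁ ξ₂ : ℝ → Ω → ℝ) (t : ℝ) : MeasurableSpace Ω :=
  ⨆ s ∈ Icc 0 t, (MeasurableSpace.comap (ξ₁ s) inferInstance ⊔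
    MeasurableSpace.comap (ξ₂ s) inferInstance)

/-- The unnormalised density at `z` of the terminal value, at time `Tstar`, of a stable-1/2 random
bridge with terminal density `p`, given that its value at time `u` is `y`. -/
noncomputable def posteriorWeight (c Tstar : ℝ) (p : ℝ → ℝ) (u y z : ℝ) : ℝ :=
  if y < z then
    (z / (z - y)) ^ (3 / 2 : ℝ) *
      Real.exp (-(c ^ 2 / 2) * ((Tstar - u) ^ 2 / (z - y) - Tstar ^ 2 / z)) * p z
  else 0

/-- The normalised density `K⁻¹ * posteriorWeight`, with `K` the total mass on `(0, ∞)`. -/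
noncomputable def posteriorDensity (c Tstar : ℝ) (p : ℝ → ℝ) (u y z : ℝ) : ℝ :=
  (∫ v in Ioi 0, posteriorWeight c Tstar p u y v)⁻¹ * posteriorWeight c Tstar p u y z

/-! A random bridge is a subordinator `X` under a tilted measure: the density of the tilt is `h (X
τ)`, where `τ` is the terminal time and `h = p / f_τ` (`bridgeWeight`), and by `exists_path_law`
this holds for the law of the whole path. Computations therefore take place under the untilted
measure, where increments are independent. If `X τ = y (V) + D` with `D` independent of `V`,
integrating out `D` shows that the tilted law of `V` is its old law reweighted by `E[h (y + D)]` at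
`y = y (V)` (`map_withDensity_of_indepFun`). The path enters the new weight only through `y (V)`.

For (i), `V` is the path up to `T` and `y (V) = X T`. For (ii), `V` is the path of scaled increments
after `T`, and the independent remainder is `X T`; by the scaling of the densities these increments
form a subordinator with activity `k * (c * lam) = c₂`. In both cases the new weight depends on the
terminal value alone, so the result is again a random bridge.

For (iii), the observed history is the path on `[0, t]` together with the increments on `[T, T + lam
* t]`. The gaps `[t, T]` and `[T + lam * t, τ]` are unobserved and independent of it. The weight
sees only the total observed increment `y`, and the gaps together have the law of `X (τ - (1 + lam)
* t)`, so Bayes' formula gives the same posterior as observing the single value `y` at time `(1 +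
lam) * t`. Given the sum of the two gap increments, the mean of each is proportional to its duration
(`lintegral_proportional`). This determines the estimate of the first terminal value, and the second
follows from `ξ₂ T = k ^ 2 * (S τ - ξ₁ T)`.

The untilted increments have infinite mean, so these identities are proved for integrals in `[0,
∞]`; integrability enters only for the bridge itself. -/

/-! ### Independence of past and future increments -/

/-- Independence concerns only the generated σ-algebras, so `f'` and `g'` need not be exhibited as
compositions with `f` and `g`. -/
theorem IndepFun.of_measurable_comap {Ω α β α' β' : Type*} [MeasurableSpace Ω] {P : Measure Ω}
    [mα : MeasurableSpace α] [mβ : MeasurableSpace β] [mα' : MeasurableSpace α']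
    [mβ' : MeasurableSpace β'] {f : Ω → α} {g : Ω → β} {f' : Ω → α'} {g' : Ω → β'}
    (h : IndepFun f g P) (hf : Measurable[mα.comap f] f') (hg : Measurable[mβ.comap g] g') :
    IndepFun f' g' P := by
  rw [IndepFun_iff_Indep] at h ⊢
  exact indep_of_indep_of_le_left (indep_of_indep_of_le_right h hg.comap_le) hf.comap_le

/-- The largest element is repeated forever, which gives a sequence indexed by `ℕ` as needed for
`HasIndepIncrements.nat`. -/
theorem Finset.exists_monotone_enumeration {α : Type*} [LinearOrder α] (K : Finset α)
    (hK : K.Nonempty) :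
    ∃ τ : ℕ → α, Monotone τ ∧ (∀ i, τ i ∈ K) ∧ ∃ n, ∀ p ∈ K, ∃ i ≤ n, τ i = p := by
  obtain ⟨n, hn⟩ : ∃ n, K.card = n + 1 := ⟨K.card - 1, by have := hK.card_pos; omega⟩
  refine ⟨fun i => K.orderEmbOfFin hn ⟨min i n, by omega⟩, fun i j hij => ?_,
    fun i => K.orderEmbOfFin_mem hn _, n, fun p hp => ?_⟩
  · exact (K.orderEmbOfFin hn).monotone (Fin.mk_le_mk.2 (min_le_min_right n hij))
  · have : p ∈ Set.range (K.orderEmbOfFin hn) := by rwa [K.range_orderEmbOfFin hn]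
    obtain ⟨i, rfl⟩ := this
    refine ⟨i, by omega, ?_⟩
    exact congrArg _ (Fin.ext (min_eq_left (by omega)))

/-- For a process with independent increments, the past is independent of the future increments. -/
theorem HasIndepIncrements.indepFun_past_future {Ω : Type*} [MeasurableSpace Ω] {P : Measure Ω}
    [IsProbabilityMeasure P] {X : ℝ≥0 → Ω → ℝ} (hm : ∀ t, Measurable (X t))
    (h0 : ∀ ω, X 0 ω = 0) (hX : HasIndepIncrements X P) (T : ℝ≥0) :
    IndepFun (fun ω (s : ℝ≥0) => X (min s T) ω) (fun ω (s : ℝ≥0) => X (T + s) ω - X T ω) P := by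
  classical
  refine IndepFun.process_indepFun_process (X := fun s ω => X (min s T) ω)
    (Y := fun s ω => X (T + s) ω - X T ω) (fun s => hm _) (fun s => (hm _).sub (hm _))
    fun I J => ?_
  -- The grid contains `0`, `T` and all times that occur. Past values are then sums of grid
  -- increments of index below `m`, where `τ m = T`, and future increments are sums of those from
  -- `m` on.
  obtain ⟨τ, hτ, hτK, n, hn⟩ := Finset.exists_monotone_enumeration
    (insert 0 (insert T (I.image (min · T) ∪ J.image (T + ·)))) (by simp)
  obtain ⟨a₀, -, ha₀⟩ := hn 0 (by simp)
  have hτ0 : τ 0 = 0 := le_antisymm (ha₀ ▸ hτ (Nat.zero_le a₀)) bot_le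
  obtain ⟨m, hmn, hmT⟩ := hn T (by simp)
  set inc : ℕ → Ω → ℝ := fun i ω => X (τ (i + 1)) ω - X (τ i) ω with hinc
  have hind := (hX.nat hτ).indepFun_finset (Finset.range m) (Finset.Ico m n)
    (by
      rw [Finset.disjoint_left]
      intro i hi hi'
      simp at hi hi'
      omega) (fun i => (hm _).sub (hm _))
  refine IndepFun.of_measurable_comap hind ?_ ?_
  · refine @measurable_pi_lambda _ _ _ (_) _ _ fun i => ?_
    obtain ⟨a, -, ha⟩ := hn (min i T) (by simp; right; right; left; exact ⟨i, i.2, rfl⟩)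
    -- The enumeration may repeat values, so `a` can exceed `m` when `τ a = T`; truncating at `m`
    -- keeps the value.
    have ha' : τ (min a m) = min (i : ℝ≥0) T := by rw [hτ.map_min, ha, hmT]; simp
    have : (fun ω => X (min (i : ℝ≥0) T) ω) =
        fun ω => ∑ j ∈ Finset.range (min a m), inc j ω := by
      funext ω
      rw [← ha', Finset.sum_range_sub (fun j => X (τ j) ω), hτ0, h0, sub_zero]
    rw [this]
    refine @Finset.measurable_sum _ _ _ _ _ _ (_) _ _ fun j hj => ?_
    have hj' : j ∈ Finset.range m := by simp at hj ⊢; omega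
    exact (measurable_pi_apply (X := fun _ : Finset.range m => ℝ) ⟨j, hj'⟩).comp
      (comap_measurable fun ω (i : Finset.range m) => inc i ω)
  · refine @measurable_pi_lambda _ _ _ (_) _ _ fun i => ?_
    obtain ⟨a, han, ha⟩ := hn (T + i) (by simp)
    have ha' : τ (max a m) = T + i := by rw [hτ.map_max, ha, hmT]; simp
    have : (fun ω => X (T + i) ω - X T ω) =
        fun ω => ∑ j ∈ Finset.Ico m (max a m), inc j ω := by
      funext ω
      rw [← ha', ← hmT, Finset.sum_Ico_sub (fun j => X (τ j) ω) (by simp)]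
    rw [this]
    refine @Finset.measurable_sum _ _ _ _ _ _ (_) _ _ fun j hj => ?_
    have hj' : j ∈ Finset.Ico m n := by simp at hj ⊢; omega
    exact (measurable_pi_apply (X := fun _ : Finset.Ico m n => ℝ) ⟨j, hj'⟩).comp
      (comap_measurable fun ω (i : Finset.Ico m n) => inc i ω)

/-! ### Scaling of the stable-1/2 densities -/

theorem lintegral_eq_ofReal_mul_lintegral_comp_mul {a : ℝ} (ha : 0 < a) {F : ℝ → ℝ≥0∞}
    (hF : Measurable F) : ∫⁻ x, F x = ENNReal.ofReal a * ∫⁻ x, F (a * x) := by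
  conv_lhs => rw [← Real.smul_map_volume_mul_left ha.ne']
  rw [lintegral_smul_measure, lintegral_map hF (by fun_prop), abs_of_pos ha, smul_eq_mul]

theorem stableHalfDensity_nonneg {c t : ℝ} (hc : 0 ≤ c) (ht : 0 ≤ t) (x : ℝ) :
    0 ≤ stableHalfDensity c t x := by
  unfold stableHalfDensity; split_ifs <;> positivity

theorem stableHalfDensity_pos {c t x : ℝ} (hc : 0 < c) (ht : 0 < t) (hx : 0 < x) :
    0 < stableHalfDensity c t x := by
  unfold stableHalfDensity; rw [if_pos hx]; positivity

theorem stableHalfDensity_of_nonpos {c t x : ℝ} (hx : x ≤ 0) : stableHalfDensity c t x = 0 :=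
  if_neg hx.not_gt

@[fun_prop]
theorem measurable_stableHalfDensity (c t : ℝ) : Measurable (stableHalfDensity c t) := by
  unfold stableHalfDensity
  exact Measurable.ite measurableSet_Ioi (by fun_prop) measurable_const

/-- Scaling property of the stable-1/2 densities. -/
theorem stableHalfDensity_scale {a : ℝ} (ha : 0 < a) (c t x : ℝ) :
    stableHalfDensity (a * c) t (a ^ 2 * x) = (a ^ 2)⁻¹ * stableHalfDensity c t x := by
  unfold stableHalfDensity
  have ha2 : 0 < a ^ 2 := by positivity
  by_cases hx : 0 < x
  · rw [if_pos hx, if_pos (by positivity)]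
    have h1 : (a ^ 2 * x) ^ (3 / 2 : ℝ) = a ^ 3 * x ^ (3 / 2 : ℝ) := by
      rw [Real.mul_rpow ha2.le hx.le, ← Real.rpow_natCast, ← Real.rpow_mul ha.le,
        ← Real.rpow_natCast a 3]
      norm_num
    have h2 : (a * c) ^ 2 * t ^ 2 / (a ^ 2 * x) = c ^ 2 * t ^ 2 / x := by
      field_simp
    rw [h1, h2]
    have : x ^ (3 / 2 : ℝ) ≠ 0 := by positivity
    have : √(2 * Real.pi) ≠ 0 := by positivity
    field_simp
  · rw [if_neg hx, if_neg (by rw [mul_pos_iff_of_pos_left ha2]; exact hx), mul_zero]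

/-- Activity and time enter the density only through their product. -/
theorem stableHalfDensity_time_scale (a c t x : ℝ) :
    stableHalfDensity (c * a) t x = stableHalfDensity c (a * t) x := by
  unfold stableHalfDensity
  split_ifs
  · rw [show (c * a) ^ 2 * t ^ 2 = c ^ 2 * (a * t) ^ 2 by ring, mul_assoc c a t]
  · rfl

/-! ### Stable-1/2 subordinators -/

namespace IsStableHalfSubordinator

variable {Ω : Type*} [MeasurableSpace Ω] {c : ℝ} {S : ℝ≥0 → Ω → ℝ} {P : Measure Ω}

theorem measurable_sub (hS : IsStableHalfSubordinator c S P) (s t : ℝ≥0) :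
    Measurable fun ω => S t ω - S s ω :=
  (hS.measurable t).sub (hS.measurable s)

theorem measurable_path (hS : IsStableHalfSubordinator c S P) (τ : ℝ≥0) :
    Measurable fun ω (t : ℝ≥0) => S (min t τ) ω :=
  measurable_pi_lambda _ fun _ => hS.measurable _

theorem nonneg (hS : IsStableHalfSubordinator c S P) (t : ℝ≥0) (ω : Ω) : 0 ≤ S t ω := by
  rw [← hS.start ω]; exact hS.mono ω bot_le

theorem ae_nonneg_map (hX : IsStableHalfSubordinator c X P) (t : ℝ≥0) :
    ∀ᵐ x ∂(P.map (X t)), 0 ≤ x :=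
  (ae_map_iff (hX.measurable t).aemeasurable measurableSet_Ici).2 (ae_of_all _ (hX.nonneg t))

theorem map_eq_withDensity (hS : IsStableHalfSubordinator c S P) {t : ℝ≥0} (ht : 0 < t) :
    P.map (S t) = volume.withDensity fun x => ENNReal.ofReal (stableHalfDensity c t x) := by
  have := hS.law 0 t ht
  simpa [hS.start] using this

theorem map_sub (hS : IsStableHalfSubordinator c S P) {s t : ℝ≥0} (hst : s ≤ t) :
    P.map (fun ω => S t ω - S s ω) = P.map (S (t - s)) := by
  rcases hst.eq_or_lt with rfl | h
  · have : S 0 = fun _ => 0 := funext hS.start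
    simp [this]
  · rw [hS.law s t h, hS.map_eq_withDensity (tsub_pos_of_lt h), NNReal.coe_sub hst]

theorem map_add_sub (hS : IsStableHalfSubordinator c S P) (s t : ℝ≥0) :
    P.map (fun ω => S (s + t) ω - S s ω) = P.map (S t) := by
  rw [hS.map_sub le_self_add, add_tsub_cancel_left]

/-- The convolution semigroup property, from the independence of `S s` and the increment that
follows it. -/
theorem lintegral_map_add [IsProbabilityMeasure P] (hS : IsStableHalfSubordinator c S P)
    (s t : ℝ≥0) {F : ℝ → ℝ≥0∞} (hF : Measurable F) :
    ∫⁻ z, F z ∂(P.map (S (s + t))) = ∫⁻ x, ∫⁻ y, F (x + y) ∂(P.map (S t)) ∂(P.map (S s)) := by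
  have hi : IndepFun (S s) (fun ω => S (s + t) ω - S s ω) P :=
    hS.indep.indepFun_eval_sub (r := 0) bot_le le_self_add (ae_of_all _ hS.start)
  have hmeas := hS.measurable_sub s (s + t)
  rw [indepFun_iff_map_prod_eq_prod_map_map (hS.measurable s).aemeasurable hmeas.aemeasurable]
    at hi
  rw [hS.map_add_sub s t] at hi
  have : IsProbabilityMeasure (P.map (S t)) :=
    Measure.isProbabilityMeasure_map (hS.measurable t).aemeasurable
  rw [lintegral_map hF (hS.measurable _), ← lintegral_prod (fun p : ℝ × ℝ => F (p.1 + p.2))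
    (by fun_prop), ← hi, lintegral_map (by fun_prop) ((hS.measurable s).prodMk hmeas)]
  simp

/-- Increments after time `r`, run at speed `l` and scaled by `a ^ 2`, form again a stable-1/2
subordinator. -/
theorem shift_scale (hS : IsStableHalfSubordinator c S P) (r : ℝ≥0) {l : ℝ≥0} (hl : 0 < l) {a : ℝ}
    (ha : 0 < a) :
    IsStableHalfSubordinator (a * (c * l)) (fun t ω => a ^ 2 * (S (r + l * t) ω - S r ω)) P where
  measurable t := ((hS.measurable _).sub (hS.measurable _)).const_mul _
  start ω := by simp
  mono ω s t hst := by
    have : S (r + l * s) ω ≤ S (r + l * t) ω := hS.mono ω (by gcongr)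
    have : 0 ≤ a ^ 2 := by positivity
    dsimp only
    gcongr
  rightCts ω t := by
    have h1 : ContinuousWithinAt (fun s => S s ω) (Ici (r + l * t)) ((fun s => r + l * s) t) :=
      hS.rightCts ω (r + l * t)
    have h2 : ContinuousWithinAt (fun s : ℝ≥0 => r + l * s) (Ici t) t :=
      Continuous.continuousWithinAt (by fun_prop)
    have h3 : MapsTo (fun s : ℝ≥0 => r + l * s) (Ici t) (Ici (r + l * t)) := by
      intro s hs
      have : t ≤ s := hs
      simp only [mem_Ici]
      gcongr
    exact ((ContinuousWithinAt.comp (f := fun s : ℝ≥0 => r + l * s) h1 h2 h3).sub continuousWithinAt_const).const_smul (a ^ 2)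
  indep := by
    intro n t ht
    have := (hS.indep n (fun i => r + l * t i) (fun i j hij => by
      dsimp only; have := ht hij; gcongr)).comp (fun _ x => a ^ 2 * x) (fun _ => by fun_prop)
    convert! this using 3
    simp [Function.comp]; ring
  law s t hst := by
    have hlt : r + l * s < r + l * t := by gcongr
    have ha2 : a ^ 2 ≠ 0 := by positivity
    have h := hS.law _ _ hlt
    have he : (fun ω => a ^ 2 * (S (r + l * t) ω - S r ω) - a ^ 2 * (S (r + l * s) ω - S r ω)) =
        (fun x => a ^ 2 * x) ∘ fun ω => S (r + l * t) ω - S (r + l * s) ω := by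
      funext ω; simp; ring
    rw [he, ← Measure.map_map (by fun_prop) (hS.measurable_sub _ _), h]
    have hmul : Measurable fun x : ℝ => a ^ 2 * x := by fun_prop
    refine Measure.ext fun B hB => ?_
    rw [Measure.map_apply hmul hB, withDensity_apply _ hB, withDensity_apply _ (hmul hB),
      ← lintegral_indicator hB, ← lintegral_indicator (hmul hB),
      lintegral_eq_ofReal_mul_lintegral_comp_mul (a := a ^ 2) (by positivity)
        (Measurable.indicator (by fun_prop) hB),
      ← lintegral_const_mul' _ _ ENNReal.ofReal_ne_top]
    congr 1
    funext x
    by_cases hx : a ^ 2 * x ∈ B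
    -- The Jacobian `a ^ 2` of the substitution cancels the factor from the scaling property.
    · rw [indicator_of_mem hx, indicator_of_mem (by exact hx), stableHalfDensity_scale ha,
        ← ENNReal.ofReal_mul (by positivity), stableHalfDensity_time_scale,
        ← mul_assoc, mul_inv_cancel₀ ha2, one_mul]
      push_cast
      ring_nf
    · rw [indicator_of_notMem hx, indicator_of_notMem (by exact hx), mul_zero]

end IsStableHalfSubordinator

/-! ### Random bridges as tilted subordinators -/

theorem lintegral_withDensity_comp {Ω α : Type*} [MeasurableSpace Ω] [MeasurableSpace α]
    {P : Measure Ω} {X : Ω → α} (hX : Measurable X) {h : α → ℝ≥0∞} (hh : Measurable h)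
    {G : Ω → ℝ≥0∞} (hG : Measurable G) :
    ∫⁻ ω, G ω ∂(P.withDensity (h ∘ X)) = ∫⁻ ω, h (X ω) * G ω ∂P :=
  lintegral_withDensity_eq_lintegral_mul P (hh.comp hX) hG

/-- Conditional laws given `X` do not change when the measure is tilted by a function of `X`. -/
theorem map_withDensity_comp_eq_compProd {Ω α β : Type*} [MeasurableSpace Ω] [MeasurableSpace α]
    [MeasurableSpace β] [StandardBorelSpace β] [Nonempty β] {P : Measure Ω}
    [IsProbabilityMeasure P] {X : Ω → α} {Y : Ω → β} (hX : Measurable X) (hY : Measurable Y)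
    {h : α → ℝ≥0∞} (hh : Measurable h) [SFinite ((P.withDensity (h ∘ X)).map X)] :
    (P.withDensity (h ∘ X)).map (fun ω => (X ω, Y ω)) =
      ((P.withDensity (h ∘ X)).map X) ⊗ₘ condDistrib Y X P := by
  refine Measure.ext_of_lintegral _ fun F hF => ?_
  have hm : Measurable fun ω => (X ω, Y ω) := hX.prodMk hY
  have hg : Measurable fun a => ∫⁻ b, F (a, b) ∂(condDistrib Y X P) a :=
    hF.lintegral_kernel_prod_right'
  rw [Measure.lintegral_compProd hF, lintegral_map hF hm, lintegral_map hg hX,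
    lintegral_withDensity_comp hX hh (G := fun ω => F (X ω, Y ω)) (hF.comp hm),
    lintegral_withDensity_comp hX hh
      (G := fun ω => ∫⁻ b, F (X ω, b) ∂(condDistrib Y X P) (X ω)) (hg.comp hX)]
  have h1 : (P.map X) ⊗ₘ condDistrib Y X P = P.map fun ω => (X ω, Y ω) :=
    compProd_map_condDistrib hY.aemeasurable
  have h2 : ∫⁻ ω, h (X ω) * F (X ω, Y ω) ∂P =
      ∫⁻ q, h q.1 * F q ∂(P.map fun ω => (X ω, Y ω)) := by
    rw [lintegral_map (by fun_prop) hm]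
  have h3 : ∫⁻ ω, h (X ω) * ∫⁻ b, F (X ω, b) ∂(condDistrib Y X P) (X ω) ∂P =
      ∫⁻ x, h x * ∫⁻ b, F (x, b) ∂(condDistrib Y X P) x ∂(P.map X) := by
    rw [lintegral_map (by fun_prop) hX]
  refine (h2.trans ?_).trans h3.symm
  rw [← h1, Measure.lintegral_compProd (by fun_prop)]
  refine lintegral_congr fun x => ?_
  exact lintegral_const_mul (h x) (f := fun b => F (x, b)) (by fun_prop)

/-- The bridge law is an almost-everywhere statement for each box separately. Countably many boxes
must therefore determine the measure, so that one null set suffices. -/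
theorem Measure.ext_of_rat_boxes {n : ℕ} {μ ν : Measure (Fin n → ℝ)} [IsProbabilityMeasure μ]
    [IsProbabilityMeasure ν]
    (h : ∀ x : Fin n → ℚ, μ {y | ∀ i, y i ≤ x i} = ν {y | ∀ i, y i ≤ x i}) : μ = ν := by
  have hgen : (MeasurableSpace.pi : MeasurableSpace (Fin n → ℝ)) =
      MeasurableSpace.generateFrom
        (pi univ '' pi univ fun _ : Fin n => ⋃ a : ℚ, {Iic (a : ℝ)}) := by
    have hs : ∀ _ : Fin n, IsCountablySpanning (⋃ a : ℚ, {Iic (a : ℝ)}) := fun _ =>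
      ⟨fun k : ℕ => Iic ((k : ℚ) : ℝ), fun k => mem_iUnion.2 ⟨k, rfl⟩, by
        rw [eq_univ_iff_forall]
        intro x
        obtain ⟨k, hk⟩ := exists_nat_ge x
        exact mem_iUnion.2 ⟨k, by simpa using hk⟩⟩
    rw [← generateFrom_pi_eq hs, ← Real.borel_eq_generateFrom_Iic_rat,
      ← BorelSpace.measurable_eq (α := ℝ)]
  refine ext_of_generate_finite _ hgen (IsPiSystem.pi fun _ => Real.isPiSystem_Iic_rat) ?_
    (by simp)
  rintro _ ⟨s, hs, rfl⟩
  simp only [mem_univ_pi, mem_iUnion, mem_singleton_iff] at hs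
  choose x hx using hs
  have : pi univ s = {y | ∀ i, y i ≤ (x i : ℝ)} := by
    ext y; simp [hx]
  rw [this, h x]

/-- The likelihood of the terminal density `p` against the law of the subordinator at time `T`. -/
noncomputable def bridgeWeight (c T : ℝ) (p : ℝ → ℝ) (z : ℝ) : ℝ≥0∞ :=
  ENNReal.ofReal (p z / stableHalfDensity c T z)

theorem measurable_bridgeWeight (c T : ℝ) {p : ℝ → ℝ} (hp : Measurable p) :
    Measurable (bridgeWeight c T p) :=
  ENNReal.measurable_ofReal.comp (hp.div (measurable_stableHalfDensity c T))

/-- On `(0, ∞)` the density `f_T` is positive and `f_T * (p / f_T) = p`; off it both measures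
vanish. -/
theorem IsStableHalfSubordinator.lawOfDensity_eq {Ω : Type*} [MeasurableSpace Ω] {c : ℝ}
    {S : ℝ≥0 → Ω → ℝ} {P : Measure Ω} (hS : IsStableHalfSubordinator c S P) (hc : 0 < c) {T : ℝ≥0}
    (hT : 0 < T) {p : ℝ → ℝ} (hp : Measurable p) :
    lawOfDensity p = (P.map (S T)).withDensity (bridgeWeight c T p) := by
  rw [hS.map_eq_withDensity hT, ← withDensity_mul _ (by fun_prop)
    (measurable_bridgeWeight c T hp), lawOfDensity, ← withDensity_indicator measurableSet_Ioi]
  congr 1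
  funext z
  have hT' : (0 : ℝ) < T := hT
  by_cases hz : 0 < z
  · have := stableHalfDensity_pos hc hT' hz
    rw [indicator_of_mem (by exact hz), Pi.mul_apply, bridgeWeight, ← ENNReal.ofReal_mul this.le,
      mul_div_cancel₀ _ this.ne']
  · rw [indicator_of_notMem (by exact hz), Pi.mul_apply, stableHalfDensity_of_nonpos (not_lt.1 hz)]
    simp

/-- The finite-dimensional laws of a random bridge, jointly with the terminal value, are those of
the subordinator under the tilted measure. -/
theorem IsStableHalfRandomBridge.exists_map_eq {Ω : Type*} [MeasurableSpace Ω] {P : Measure Ω}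
    [IsProbabilityMeasure P] {c : ℝ} (hc : 0 < c) {T : ℝ≥0} (hT : 0 < T) {p : ℝ → ℝ}
    {ξ : ℝ → Ω → ℝ} (hξ : IsStableHalfRandomBridge c T p ξ P) :
    ∃ (Ω' : Type) (_ : MeasurableSpace Ω') (P' : Measure Ω') (_ : IsProbabilityMeasure P')
      (S : ℝ≥0 → Ω' → ℝ), IsStableHalfSubordinator c S P' ∧
      IsProbabilityMeasure (P'.withDensity (bridgeWeight c T p ∘ S T)) ∧
      ∀ (n : ℕ) (t : Fin n → ℝ), StrictMono t → (∀ i, t i ∈ Ioo 0 (T : ℝ)) →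
        P.map (fun ω => (ξ T ω, fun i => ξ (t i) ω)) =
          (P'.withDensity (bridgeWeight c T p ∘ S T)).map
            (fun ω => (S T ω, fun i => S (t i).toNNReal ω)) := by
  obtain ⟨Ω', m', P', hP', S, hS, hb⟩ := hξ.bridge_law
  have hw := measurable_bridgeWeight c T hξ.density_measurable
  have hmT : Measurable (ξ T) := hξ.measurable T ⟨T.2, le_rfl⟩
  have hlaw : (P'.withDensity (bridgeWeight c T p ∘ S T)).map (S T) = P.map (ξ T) := by
    rw [hξ.terminal_law, hS.lawOfDensity_eq hc hT hξ.density_measurable]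
    refine Measure.ext fun B hB => ?_
    rw [Measure.map_apply (hS.measurable T) hB, withDensity_apply _ (hS.measurable T hB),
      withDensity_apply _ hB, setLIntegral_map hB hw (hS.measurable T)]
    rfl
  have hPT : IsProbabilityMeasure (P.map (ξ T)) := Measure.isProbabilityMeasure_map hmT.aemeasurable
  refine ⟨Ω', m', P', hP', S, hS, ?_, fun n t ht htT => ?_⟩
  · rw [← hlaw] at hPT
    exact ⟨by
      have := hPT.measure_univ
      rwa [Measure.map_apply (hS.measurable T) MeasurableSet.univ, preimage_univ] at this⟩
  · have hsf : SFinite ((P'.withDensity (bridgeWeight c T p ∘ S T)).map (S T)) := by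
      rw [hlaw]; infer_instance
    have hmt : Measurable fun ω i => ξ (t i) ω :=
      measurable_pi_lambda _ fun i => hξ.measurable _ (Ioo_subset_Icc_self (htT i))
    have hmt' : Measurable fun ω i => S (t i).toNNReal ω :=
      measurable_pi_lambda _ fun i => hS.measurable _
    rw [map_withDensity_comp_eq_compProd (hS.measurable T) hmt' hw, hlaw,
      ← compProd_map_condDistrib hmt.aemeasurable]
    refine Measure.compProd_congr ?_
    have hall : ∀ᵐ z ∂(P.map (ξ T)), ∀ x : Fin n → ℚ,
        condDistrib (fun ω i => ξ (t i) ω) (ξ T) P z {y | ∀ i, y i ≤ x i} =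
          condDistrib (fun ω i => S (t i).toNNReal ω) (S T) P' z {y | ∀ i, y i ≤ x i} := by
      rw [ae_all_iff, hξ.terminal_law]
      intro x
      simpa using hb n t ht htT fun i => x i
    filter_upwards [hall] with z hz
    exact Measure.ext_of_rat_boxes hz

/-- The law of the whole path of a random bridge is the law of the path of a subordinator under
the measure tilted by a function of the terminal value. -/
theorem IsStableHalfRandomBridge.exists_path_law {Ω : Type*} [MeasurableSpace Ω] {P : Measure Ω}
    [IsProbabilityMeasure P] {c : ℝ} (hc : 0 < c) {T : ℝ≥0} (hT : 0 < T) {p : ℝ → ℝ}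
    {ξ : ℝ → Ω → ℝ} (hξ : IsStableHalfRandomBridge c T p ξ P) :
    ∃ (Ω' : Type) (_ : MeasurableSpace Ω') (P' : Measure Ω') (_ : IsProbabilityMeasure P')
      (S : ℝ≥0 → Ω' → ℝ), IsStableHalfSubordinator c S P' ∧
      IsProbabilityMeasure (P'.withDensity (bridgeWeight c T p ∘ S T)) ∧
      P.map (fun ω (t : ℝ≥0) => ξ (min t T : ℝ≥0) ω) =
        (P'.withDensity (bridgeWeight c T p ∘ S T)).map (fun ω t => S (min t T) ω) := by
  classical
  obtain ⟨Ω', m', P', hP', S, hS, hQ, hfdd⟩ := hξ.exists_map_eq hc hT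
  refine ⟨Ω', m', P', hP', S, hS, hQ, ?_⟩
  set Q := P'.withDensity (bridgeWeight c T p ∘ S T)
  have hmξ : ∀ t : ℝ≥0, Measurable (ξ (min t T : ℝ≥0)) := fun t =>
    hξ.measurable _ ⟨(min t T).2, NNReal.coe_le_coe.2 (min_le_right t T)⟩
  have h1 := isProjectiveLimit_map (P := P) (X := fun (t : ℝ≥0) ω => ξ (min t T : ℝ≥0) ω)
    (measurable_pi_lambda _ hmξ).aemeasurable
  have h2 := isProjectiveLimit_map (P := Q) (X := fun (t : ℝ≥0) ω => S (min t T) ω)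
    (measurable_pi_lambda _ fun t => hS.measurable _).aemeasurable
  refine IsProjectiveLimit.unique h1 ?_
  convert h2 using 2 with I
  -- The finite-dimensional laws are known only for strictly increasing times in `(0, T)`. Any other
  -- time in `I` is `0`, where the path vanishes, or is at least `T`, where truncation gives the
  -- terminal value; `Φ` rebuilds all coordinates from this.
  set J := I.filter fun s => 0 < s ∧ s < T with hJ
  set e := J.orderEmbOfFin rfl with he
  have heJ : ∀ j, 0 < e j ∧ e j < T := fun j =>
    (Finset.mem_filter.1 (J.orderEmbOfFin_mem rfl j)).2
  have key : ∀ i : I, (¬ ∃ j, e j = i) → (i : ℝ≥0) ≠ 0 → T ≤ i := by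
    intro i hi hi0
    by_contra! hlt
    have : (i : ℝ≥0) ∈ J := Finset.mem_filter.2 ⟨i.2, pos_iff_ne_zero.2 hi0, hlt⟩
    rw [← Finset.mem_coe, ← J.range_orderEmbOfFin rfl] at this
    exact hi this
  let Φ : ℝ × (Fin J.card → ℝ) → (I → ℝ) := fun q i =>
    if h : ∃ j, e j = i then q.2 h.choose else if (i : ℝ≥0) = 0 then 0 else q.1
  have hΦ : Measurable Φ := by
    refine measurable_pi_lambda _ fun i => ?_
    by_cases h : ∃ j, e j = i
    · simp only [Φ, dif_pos h]; fun_prop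
    · by_cases h0 : (i : ℝ≥0) = 0
      · simp only [Φ, dif_neg h, if_pos h0]; fun_prop
      · simp only [Φ, dif_neg h, if_neg h0]; fun_prop
  have hΦX : ∀ X : ℝ≥0 → ℝ, X 0 = 0 →
      (I.restrict fun t => X (min t T)) = Φ (X T, fun j => X (e j)) := by
    intro X hX
    funext i
    by_cases h : ∃ j, e j = i
    · simp only [Φ, dif_pos h, Finset.restrict]
      rw [h.choose_spec, min_eq_left]
      rw [← h.choose_spec]; exact (heJ _).2.le
    · by_cases h0 : (i : ℝ≥0) = 0
      · simp only [Φ, dif_neg h, Finset.restrict, h0]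
        simpa using hX
      · simp only [Φ, dif_neg h, if_neg h0, Finset.restrict]
        rw [min_eq_right (key i h h0)]
  have hf := hfdd J.card (fun j => (e j : ℝ))
    (fun i j hij => NNReal.coe_lt_coe.2 (e.strictMono hij))
    (fun i => ⟨NNReal.coe_pos.2 (heJ i).1, NNReal.coe_lt_coe.2 (heJ i).2⟩)
  simp only [Real.toNNReal_coe] at hf
  have hL : P.map (fun ω => I.restrict fun t : ℝ≥0 => ξ (min t T : ℝ≥0) ω) =
      (P.map fun ω => (ξ T ω, fun j => ξ (e j) ω)).map Φ := by
    have hm : Measurable fun ω => (ξ T ω, fun j => ξ (e j) ω) :=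
      (hξ.measurable T ⟨T.2, le_rfl⟩).prodMk (measurable_pi_lambda _ fun j =>
        hξ.measurable _ ⟨(e j).2, NNReal.coe_le_coe.2 (heJ j).2.le⟩)
    rw [Measure.map_map hΦ hm]
    refine Measure.map_congr ?_
    filter_upwards [hξ.start] with ω hω
    exact hΦX (fun t => ξ t ω) (by simpa using hω)
  have hR : Q.map (fun ω => I.restrict fun t : ℝ≥0 => S (min t T) ω) =
      (Q.map fun ω => (S T ω, fun j => S (e j) ω)).map Φ := by
    have hm : Measurable fun ω => (S T ω, fun j => S (e j) ω) :=
      (hS.measurable T).prodMk (measurable_pi_lambda _ fun j => hS.measurable _)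
    rw [Measure.map_map hΦ hm]
    congr 1
    funext ω
    exact hΦX (fun t => S t ω) (hS.start ω)
  rw [hL, hR, hf]

/-! ### Recognising a random bridge from its path law -/

/-- Tilting by a function of `y (V)` and an independent `D` tilts the law of `V` by a function of
`y (V)` alone. -/
theorem map_withDensity_of_indepFun {Ω E F : Type*} [MeasurableSpace Ω] [MeasurableSpace E]
    [MeasurableSpace F] {P : Measure Ω} [IsProbabilityMeasure P] {V : Ω → E} {D : Ω → F} (hV : Measurable V)
    (hD : Measurable D) (hi : IndepFun V D P) {y : E → ℝ} (hy : Measurable y) {H : ℝ → F → ℝ≥0∞}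
    (hH : Measurable (Function.uncurry H)) :
    (P.withDensity fun ω => H (y (V ω)) (D ω)).map V =
      (P.map V).withDensity fun v => ∫⁻ w, H (y v) w ∂(P.map D) := by
  have : IsProbabilityMeasure (P.map D) := Measure.isProbabilityMeasure_map hD.aemeasurable
  have hH' : Measurable fun q : E × F => H (y q.1) q.2 :=
    hH.comp ((hy.comp measurable_fst).prodMk measurable_snd)
  rw [indepFun_iff_map_prod_eq_prod_map_map hV.aemeasurable hD.aemeasurable] at hi
  refine Measure.ext_of_lintegral _ fun G hG => ?_
  rw [lintegral_map hG hV, lintegral_withDensity_eq_lintegral_mul _ (g := fun ω => G (V ω))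
    (f := fun ω => H (y (V ω)) (D ω))
    (hH'.comp (hV.prodMk hD)) (hG.comp hV), lintegral_withDensity_eq_lintegral_mul _
    hH'.lintegral_prod_right' hG]
  have hHG : Measurable fun q : E × F => H (y q.1) q.2 * G q.1 := hH'.mul (hG.comp measurable_fst)
  have h1 : ∫⁻ q, H (y q.1) q.2 * G q.1 ∂(P.map fun ω => (V ω, D ω)) =
      ∫⁻ ω, H (y (V ω)) (D ω) * G (V ω) ∂P :=
    lintegral_map hHG (hV.prodMk hD)
  refine h1.symm.trans ?_
  rw [hi, lintegral_prod _ hHG.aemeasurable]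
  refine lintegral_congr fun v => ?_
  exact lintegral_mul_const (G v) (f := fun w => H (y v) w) (hH'.comp measurable_prodMk_left)

/-- A process whose finite-dimensional laws are those of a subordinator tilted by a function of
its terminal value satisfies the bridge law. -/
theorem condDistrib_eq_of_map_eq_tilt {Ω Ω' α β : Type*} [MeasurableSpace Ω] [MeasurableSpace Ω']
    [MeasurableSpace α] [MeasurableSpace β] [StandardBorelSpace β] [Nonempty β]
    {P : Measure Ω} [IsProbabilityMeasure P] {P' : Measure Ω'} [IsProbabilityMeasure P']
    {X : Ω → α} {Y : Ω → β} {X' : Ω' → α} {Y' : Ω' → β} (hX : Measurable X) (hY : Measurable Y)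
    (hX' : Measurable X') (hY' : Measurable Y') {g : α → ℝ≥0∞} (hg : Measurable g)
    (h : P.map (fun ω => (X ω, Y ω)) = (P'.map fun ω => (X' ω, Y' ω)).withDensity fun q => g q.1) :
    ∀ᵐ z ∂(P.map X), condDistrib Y X P z = condDistrib Y' X' P' z := by
  have hq : (P'.map fun ω => (X' ω, Y' ω)).withDensity (fun q => g q.1) =
      (P'.withDensity (g ∘ X')).map fun ω => (X' ω, Y' ω) := by
    refine Measure.ext fun B hB => ?_
    have hm := hX'.prodMk hY'
    rw [Measure.map_apply hm hB, withDensity_apply _ hB, withDensity_apply _ (hm hB),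
      setLIntegral_map hB (by fun_prop) hm]
    rfl
  have hm : P.map X = (P'.withDensity (g ∘ X')).map X' := by
    have := congrArg (Measure.map Prod.fst) (h.trans hq)
    rwa [Measure.map_map measurable_fst (hX.prodMk hY),
      Measure.map_map measurable_fst (hX'.prodMk hY')] at this
  have : IsProbabilityMeasure (P.map X) := Measure.isProbabilityMeasure_map hX.aemeasurable
  refine condDistrib_ae_eq_of_measure_eq_compProd X hY.aemeasurable ?_
  have : SFinite ((P'.withDensity (g ∘ X')).map X') := by rw [← hm]; infer_instance
  rw [h, hq, map_withDensity_comp_eq_compProd hX' hY' hg, ← hm]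

/-- A process whose path law is that of a subordinator tilted by a function of the terminal value
is a random bridge. -/
theorem IsStableHalfSubordinator.isStableHalfRandomBridge {Ω : Type*} [MeasurableSpace Ω]
    {P : Measure Ω} [IsProbabilityMeasure P] {Ω' : Type} [MeasurableSpace Ω'] {P' : Measure Ω'}
    [IsProbabilityMeasure P'] {c : ℝ} {S : ℝ≥0 → Ω' → ℝ} (hS : IsStableHalfSubordinator c S P')
    {T : ℝ≥0} {g : ℝ → ℝ≥0∞} (hg : Measurable g) {q : ℝ → ℝ} (hq : Measurable q)
    (hq0 : ∀ z, 0 < z → 0 ≤ q z) {ξ : ℝ → Ω → ℝ} (hξ : ∀ t ∈ Icc 0 (T : ℝ), Measurable (ξ t))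
    (hpath : P.map (fun ω (t : ℝ≥0) => ξ (min t T : ℝ≥0) ω) =
      (P'.map fun ω (t : ℝ≥0) => S (min t T) ω).withDensity fun x => g (x T))
    (hqg : lawOfDensity q = (P'.map (S T)).withDensity g)
    (hstart : ∀ᵐ ω ∂P, ξ 0 ω = 0)
    (hright : ∀ ω, ∀ t ∈ Ico 0 (T : ℝ), ContinuousWithinAt (fun s => ξ s ω) (Ici t) t)
    (hleft : ∀ ω, ∀ t ∈ Ioc 0 (T : ℝ), ∃ l : ℝ, Tendsto (fun s => ξ s ω) (𝓝[<] t) (𝓝 l)) :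
    IsStableHalfRandomBridge c T q ξ P := by
  have hmξ : Measurable (fun ω (t : ℝ≥0) => ξ (min t T : ℝ≥0) ω) :=
    measurable_pi_lambda _ fun t => hξ _ ⟨(min t T).coe_nonneg, NNReal.coe_le_coe.2 (min_le_right t T)⟩
  have hmS : Measurable (fun ω (t : ℝ≥0) => S (min t T) ω) :=
    measurable_pi_lambda _ fun t => hS.measurable _
  -- The density depends on the terminal value only, so it survives any image `R` of the path from
  -- which that value can be recovered.
  have hmap : ∀ {α : Type} [MeasurableSpace α] (R : (ℝ≥0 → ℝ) → α) (e : α → ℝ),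
      Measurable R → Measurable e → (∀ x, e (R x) = x T) →
      P.map (fun ω => R fun t : ℝ≥0 => ξ (min t T : ℝ≥0) ω) =
        (P'.map fun ω => R fun t : ℝ≥0 => S (min t T) ω).withDensity fun a => g (e a) := by
    intro α _ R e hR he hRe
    have h1 : P.map (fun ω => R fun t : ℝ≥0 => ξ (min t T : ℝ≥0) ω) =
        (P.map fun ω (t : ℝ≥0) => ξ (min t T : ℝ≥0) ω).map R := (Measure.map_map hR hmξ).symm
    have h2 : P'.map (fun ω => R fun t : ℝ≥0 => S (min t T) ω) =
        (P'.map fun ω (t : ℝ≥0) => S (min t T) ω).map R := (Measure.map_map hR hmS).symm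
    rw [h1, hpath, h2]
    refine Measure.ext fun B hB => ?_
    rw [Measure.map_apply hR hB, withDensity_apply _ hB, withDensity_apply _ (hR hB),
      setLIntegral_map hB (by fun_prop) hR]
    simp only [hRe]
  have hT : P.map (ξ T) = lawOfDensity q := by
    have := hmap (fun x => x T) id (by fun_prop) measurable_id (fun _ => rfl)
    simpa [hqg] using this
  refine ⟨hξ, hstart, hright, hleft, hq, hq0, hT, Ω', ‹_›, P', ‹_›, S, hS, fun n t ht htT x => ?_⟩
  have hmt : Measurable fun ω i => ξ (t i) ω :=
    measurable_pi_lambda _ fun i => hξ _ (Ioo_subset_Icc_self (htT i))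
  have hmt' : Measurable fun ω i => S (t i).toNNReal ω :=
    measurable_pi_lambda _ fun i => hS.measurable _
  have hjoint := hmap (fun x => (x T, fun i : Fin n => x (t i).toNNReal)) Prod.fst (by fun_prop)
    measurable_fst (fun _ => rfl)
  have hmin : ∀ i, min (t i).toNNReal T = (t i).toNNReal := fun i =>
    min_eq_left (Real.toNNReal_le_iff_le_coe.2 (htT i).2.le)
  have hcoe : ∀ i, (((t i).toNNReal : ℝ≥0) : ℝ) = t i := fun i => Real.coe_toNNReal _ (htT i).1.le
  simp only [min_self, hmin, hcoe] at hjoint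
  have := condDistrib_eq_of_map_eq_tilt (hξ T ⟨T.coe_nonneg, le_rfl⟩) hmt (hS.measurable T) hmt' hg hjoint
  rw [hT] at this
  filter_upwards [this] with z hz
  rw [hz, Real.toNNReal_coe]

/-- The law with density `y ↦ ∫ G y z dz`, when `G` is a product of a density in `y` and a weight
that is an integral over `z`. -/
theorem lawOfDensity_integral_eq {G : ℝ → ℝ → ℝ} (hG : Measurable (Function.uncurry G))
    (hG0 : ∀ y z, 0 < z → 0 ≤ G y z) {f : ℝ → ℝ} (hf : Measurable f) (hf0 : ∀ y ≤ 0, f y = 0)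
    {g : ℝ → ℝ≥0∞} (hg : Measurable g)
    (hfin : ∫⁻ y, g y ∂(volume.withDensity fun y => ENNReal.ofReal (f y)) ≠ ∞)
    (hfg : ∀ y, 0 < y → ENNReal.ofReal (f y) * g y = ∫⁻ z in Ioi 0, ENNReal.ofReal (G y z)) :
    lawOfDensity (fun y => ∫ z in Ioi 0, G y z) =
      (volume.withDensity fun y => ENNReal.ofReal (f y)).withDensity g := by
  have hm : Measurable fun y => ENNReal.ofReal (f y) := by fun_prop
  rw [← withDensity_mul _ hm hg, lawOfDensity, ← withDensity_indicator measurableSet_Ioi]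
  refine withDensity_congr_ae ?_
  rw [lintegral_withDensity_eq_lintegral_mul _ hm hg] at hfin
  -- The Bochner integral defaults to `0` where `G y` is not integrable; finite total mass makes
  -- this a null set of `y`.
  filter_upwards [ae_lt_top (hm.mul hg) hfin] with y hy
  by_cases hy0 : 0 < y
  · rw [indicator_of_mem (by exact hy0)]
    rw [Pi.mul_apply, hfg y hy0] at hy ⊢
    have hGy : Measurable (G y) := hG.comp measurable_prodMk_left
    have hnn : 0 ≤ᵐ[volume.restrict (Ioi 0)] G y :=
      (ae_restrict_iff' measurableSet_Ioi).2 (ae_of_all _ fun z hz => hG0 y z hz)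
    refine ofReal_integral_eq_lintegral_ofReal ⟨hGy.aestronglyMeasurable, ?_⟩ hnn
    rwa [hasFiniteIntegral_iff_ofReal hnn]
  · rw [indicator_of_notMem (by exact hy0), Pi.mul_apply, hf0 y (not_lt.1 hy0)]
    simp

theorem measurable_stableHalfBridgeDensity (c t T : ℝ) :
    Measurable (Function.uncurry (stableHalfBridgeDensity c t T)) := by
  unfold stableHalfBridgeDensity Function.uncurry
  fun_prop

theorem stableHalfBridgeDensity_nonneg {c t T : ℝ} (hc : 0 ≤ c) (ht : 0 ≤ t) (htT : t ≤ T)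
    (y z : ℝ) : 0 ≤ stableHalfBridgeDensity c t T y z :=
  div_nonneg (mul_nonneg (stableHalfDensity_nonneg hc ht _)
    (stableHalfDensity_nonneg hc (sub_nonneg.2 htT) _)) (stableHalfDensity_nonneg hc (ht.trans htT) _)

/-- Translation by `y` turns an average over the increment into an integral over the terminal value
`z = y + w`. -/
theorem IsStableHalfSubordinator.lintegral_weight_add {Ω : Type*} [MeasurableSpace Ω]
    {P : Measure Ω} {c : ℝ} {S : ℝ≥0 → Ω → ℝ} (hS : IsStableHalfSubordinator c S P) {s : ℝ≥0}
    (hs : 0 < s) {h : ℝ → ℝ≥0∞} (hh : Measurable h) (y : ℝ) :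
    ∫⁻ w, h (y + w) ∂(P.map (S s)) =
      ∫⁻ z, ENNReal.ofReal (stableHalfDensity c s (z - y)) * h z := by
  have := lintegral_sub_right_eq_self (μ := volume)
    (fun w => ENNReal.ofReal (stableHalfDensity c s w) * h (y + w)) y
  simp only [add_sub_cancel] at this
  rw [this, hS.map_eq_withDensity hs]
  exact lintegral_withDensity_eq_lintegral_mul _ (by fun_prop) (by fun_prop)

theorem bridgeWeight_of_nonpos {c T z : ℝ} {p : ℝ → ℝ} (hz : z ≤ 0) : bridgeWeight c T p z = 0 := by
  simp [bridgeWeight, stableHalfDensity_of_nonpos hz]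

/-- A process whose path law is that of a subordinator tilted by `g` of the terminal value is a
random bridge, with the terminal density `x ↦ ∫ G x z dz` if this is a version of `f * g`. -/
theorem IsStableHalfSubordinator.isStableHalfRandomBridge_integral {Ω : Type*} [MeasurableSpace Ω]
    {P : Measure Ω} [IsProbabilityMeasure P] {Ω' : Type} [MeasurableSpace Ω'] {P' : Measure Ω'}
    [IsProbabilityMeasure P'] {c : ℝ} {S : ℝ≥0 → Ω' → ℝ} (hS : IsStableHalfSubordinator c S P')
    {T : ℝ≥0} (hT : 0 < T) {g : ℝ → ℝ≥0∞} (hg : Measurable g) {G : ℝ → ℝ → ℝ}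
    (hG : Measurable (Function.uncurry G)) (hG0 : ∀ y z, 0 < z → 0 ≤ G y z)
    {ξ : ℝ → Ω → ℝ} (hξ : ∀ t ∈ Icc 0 (T : ℝ), Measurable (ξ t))
    (hpath : P.map (fun ω (t : ℝ≥0) => ξ (min t T : ℝ≥0) ω) =
      (P'.map fun ω (t : ℝ≥0) => S (min t T) ω).withDensity fun x => g (x T))
    (hfg : ∀ y, 0 < y → ENNReal.ofReal (stableHalfDensity c T y) * g y =
      ∫⁻ z in Ioi 0, ENNReal.ofReal (G y z))
    (hstart : ∀ᵐ ω ∂P, ξ 0 ω = 0)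
    (hright : ∀ ω, ∀ t ∈ Ico 0 (T : ℝ), ContinuousWithinAt (fun s => ξ s ω) (Ici t) t)
    (hleft : ∀ ω, ∀ t ∈ Ioc 0 (T : ℝ), ∃ l : ℝ, Tendsto (fun s => ξ s ω) (𝓝[<] t) (𝓝 l)) :
    IsStableHalfRandomBridge c T (fun x => ∫ z in Ioi 0, G x z) ξ P := by
  refine hS.isStableHalfRandomBridge hg
    (StronglyMeasurable.integral_prod_right' hG.stronglyMeasurable).measurable
    (fun y hy => setIntegral_nonneg measurableSet_Ioi fun z hz => hG0 y z hz) hξ hpath ?_ hstart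
    hright hleft
  rw [hS.map_eq_withDensity hT]
  refine lawOfDensity_integral_eq hG hG0 (by fun_prop)
    (fun y hy => stableHalfDensity_of_nonpos hy) hg ?_ hfg
  -- Comparing total masses shows that `g` has integral `1` against the law of `S T`, hence the
  -- required finiteness.
  have h1 := congrArg (fun μ => μ univ) hpath
  have : IsProbabilityMeasure (P.map (fun ω (t : ℝ≥0) => ξ (min t T : ℝ≥0) ω)) :=
    Measure.isProbabilityMeasure_map (measurable_pi_lambda _ fun t => hξ _
      ⟨(min t T).coe_nonneg, NNReal.coe_le_coe.2 (min_le_right t T)⟩).aemeasurable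
  simp only [measure_univ, withDensity_apply _ MeasurableSet.univ, Measure.restrict_univ] at h1
  rw [lintegral_map (by fun_prop) (measurable_pi_lambda _ fun t => hS.measurable _)] at h1
  rw [← hS.map_eq_withDensity hT, lintegral_map hg (hS.measurable T)]
  simp only [min_self] at h1
  rw [← h1]
  simp

/-! ### The initial part of a random bridge -/

section

variable {Ω : Type*} [MeasurableSpace Ω] {P : Measure Ω} [IsProbabilityMeasure P] {c : ℝ}
  {T τ : ℝ≥0} {p : ℝ → ℝ} {S : ℝ → Ω → ℝ}

theorem IsStableHalfRandomBridge.measurable_path (hS : IsStableHalfRandomBridge c τ p S P) :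
    Measurable fun ω (t : ℝ≥0) => S (min t τ : ℝ≥0) ω :=
  measurable_pi_lambda _ fun t =>
    hS.measurable _ ⟨(min t τ).coe_nonneg, NNReal.coe_le_coe.2 (min_le_right t τ)⟩

/-- The initial part of a random bridge is a random bridge. -/
theorem IsStableHalfRandomBridge.initial (hc : 0 < c) (hT : 0 < T) (hTτ : T < τ)
    (hS : IsStableHalfRandomBridge c τ p S P) {ξ : ℝ → Ω → ℝ}
    (hξ : ∀ t ∈ Icc 0 (T : ℝ), ∀ ω, ξ t ω = S t ω) :
    IsStableHalfRandomBridge c T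
      (fun x => ∫ z in Ioi 0, stableHalfBridgeDensity c T τ x z * p z) ξ P := by
  obtain ⟨Ω', m', P', hP', X, hX, hQ, hlaw⟩ := hS.exists_path_law hc (hT.trans hTτ)
  have hTτ' : (T : ℝ) < τ := hTτ
  have hw := measurable_bridgeWeight c τ hS.density_measurable
  set h := bridgeWeight c τ p with hh
  have hξS : ∀ t ∈ Icc 0 (T : ℝ), ξ t = S t := fun t ht => funext (hξ t ht)
  have hIcc : ∀ t ∈ Icc 0 (T : ℝ), t ∈ Icc 0 (τ : ℝ) := fun t ht => ⟨ht.1, ht.2.trans hTτ'.le⟩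
  -- The terminal weight averaged over the increment on `[T, τ]`, given the value `y` at time `T`.
  set g : ℝ → ℝ≥0∞ := fun y => ∫⁻ w, h (y + w) ∂(P'.map (X (τ - T)))
  have : IsProbabilityMeasure (P'.map (X (τ - T))) :=
    Measure.isProbabilityMeasure_map (hX.measurable _).aemeasurable
  have hg : Measurable g :=
    (hw.comp (measurable_fst.add measurable_snd)).lintegral_prod_right'
  have hmV := hX.measurable_path T
  have hpath : P.map (fun ω (t : ℝ≥0) => ξ (min t T : ℝ≥0) ω) =
      (P'.map fun ω (t : ℝ≥0) => X (min t T) ω).withDensity fun x => g (x T) := by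
    have hR : Measurable fun (x : ℝ≥0 → ℝ) (t : ℝ≥0) => x (min t T) := by fun_prop
    have hind := IndepFun.of_measurable_comap (f' := fun ω (t : ℝ≥0) => X (min t T) ω)
      (g' := fun ω => X τ ω - X T ω)
      (HasIndepIncrements.indepFun_past_future hX.measurable hX.start hX.indep T)
      (comap_measurable _) (by
        have := (measurable_pi_apply (X := fun _ : ℝ≥0 => ℝ) (τ - T)).comp
          (comap_measurable fun ω (s : ℝ≥0) => X (T + s) ω - X T ω)
        simpa [Function.comp_def, add_tsub_cancel_of_le hTτ.le] using this)
    have htilt := map_withDensity_of_indepFun hmV (hX.measurable_sub T τ) hind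
      (y := fun x => x T) (by fun_prop) (H := fun y w => h (y + w)) (by
        exact hw.comp (measurable_fst.add measurable_snd))
    rw [hX.map_sub hTτ.le] at htilt
    rw [← htilt]
    have h1 := congrArg (Measure.map fun (x : ℝ≥0 → ℝ) (t : ℝ≥0) => x (min t T)) hlaw
    rw [Measure.map_map hR hS.measurable_path, Measure.map_map hR (hX.measurable_path τ)] at h1
    have hmin : ∀ t : ℝ≥0, min (min t T) τ = min t T := fun t =>
      min_eq_left ((min_le_right _ _).trans hTτ.le)
    simp only [Function.comp_def, hmin] at h1
    convert! h1 using 3 with ω ω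
    · funext t
      exact hξ _ ⟨(min t T).coe_nonneg, NNReal.coe_le_coe.2 (min_le_right t T)⟩ ω
    · simp
  refine hX.isStableHalfRandomBridge_integral hT hg
    (G := fun x z => stableHalfBridgeDensity c T τ x z * p z) ((measurable_stableHalfBridgeDensity c T τ).mul
    (hS.density_measurable.comp measurable_snd)) (fun y z hz => mul_nonneg
      (stableHalfBridgeDensity_nonneg hc.le T.coe_nonneg hTτ'.le _ _) (hS.density_nonneg z hz)) ?_ hpath
      (fun y hy => ?_) ?_ ?_ ?_
  · intro t ht; rw [hξS t ht]; exact hS.measurable t (hIcc t ht)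
  · simp only [g]
    rw [hX.lintegral_weight_add (tsub_pos_of_lt hTτ) hw, ← lintegral_const_mul _ (by fun_prop),
      ← lintegral_indicator measurableSet_Ioi]
    refine lintegral_congr fun z => ?_
    by_cases hz : 0 < z
    · rw [indicator_of_mem (by exact hz), hh, bridgeWeight, NNReal.coe_sub hTτ.le,
        ← ENNReal.ofReal_mul (stableHalfDensity_nonneg hc.le (sub_nonneg.2 hTτ'.le) _),
        ← ENNReal.ofReal_mul (stableHalfDensity_nonneg hc.le T.coe_nonneg _), stableHalfBridgeDensity]
      congr 1; ring
    · rw [indicator_of_notMem (by exact hz), hh, bridgeWeight_of_nonpos (not_lt.1 hz)]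
      simp
  · filter_upwards [hS.start] with ω hω
    rw [hξ 0 ⟨le_rfl, T.coe_nonneg⟩, hω]
  · intro ω t ht
    refine ((hS.rightCts ω t ⟨ht.1, ht.2.trans hTτ'⟩).congr_of_eventuallyEq ?_
      (hξ t ⟨ht.1, ht.2.le⟩ ω))
    filter_upwards [self_mem_nhdsWithin, mem_nhdsWithin_of_mem_nhds (Iio_mem_nhds ht.2)] with s hs hs'
    exact hξ s ⟨ht.1.trans hs, hs'.le⟩ ω
  · intro ω t ht
    obtain ⟨l, hl⟩ := hS.leftLim ω t ⟨ht.1, ht.2.trans hTτ'.le⟩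
    refine ⟨l, hl.congr' ?_⟩
    filter_upwards [self_mem_nhdsWithin, mem_nhdsWithin_of_mem_nhds (Ioi_mem_nhds ht.1)] with s hs hs'
    exact (hξ s ⟨hs'.le, (le_of_lt hs).trans ht.2⟩ ω).symm

end

/-! ### The scaled later increments of a random bridge -/

section

variable {Ω : Type*} [MeasurableSpace Ω] {P : Measure Ω} [IsProbabilityMeasure P] {c : ℝ}
  {T τ : ℝ≥0} {p : ℝ → ℝ} {S : ℝ → Ω → ℝ}

/-- The increments of a random bridge after an intermediate time, suitably scaled, form a random
bridge. -/
theorem IsStableHalfRandomBridge.shifted (hc : 0 < c) (hT : 0 < T) {a : ℝ} (ha : 0 < a) {l : ℝ≥0}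
    (hl : 0 < l) (hTτ : T + l * T = τ) (hS : IsStableHalfRandomBridge c τ p S P) {ξ : ℝ → Ω → ℝ}
    (hξ : ∀ t ∈ Icc 0 (T : ℝ), ∀ ω, ξ t ω = a ^ 2 * S (l * t + T) ω - a ^ 2 * S T ω) :
    IsStableHalfRandomBridge (a * (c * l)) T
      (fun x => ∫ z in Ioi 0, (a ^ 2)⁻¹ *
        (stableHalfBridgeDensity (a * (c * l)) T ((l : ℝ)⁻¹ * τ) x z * p ((a ^ 2)⁻¹ * z))) ξ P := by
  have hTle : T ≤ τ := hTτ ▸ le_self_add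
  obtain ⟨Ω', m', P', hP', X, hX, hQ, hlaw⟩ := hS.exists_path_law hc (hT.trans_le hTle)
  have hl' : (0 : ℝ) < l := hl
  have ha2 : 0 < a ^ 2 := by positivity
  have hTτ' : (τ : ℝ) = l * T + T := by rw [← hTτ]; push_cast; ring
  have hlτ : l * ((l : ℝ)⁻¹ * τ) = τ := by field_simp
  have hTlτ : (T : ℝ) ≤ (l : ℝ)⁻¹ * τ := by
    rw [hTτ']; field_simp; linarith [T.coe_nonneg]
  have hw := measurable_bridgeWeight c τ hS.density_measurable
  set h := bridgeWeight c τ p with hh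
  have hIcc : ∀ t ∈ Icc 0 (T : ℝ), l * t + T ∈ Icc 0 (τ : ℝ) := fun t ht =>
    ⟨by have := ht.1; positivity, by rw [hTτ']; gcongr; exact ht.2⟩
  have hTIcc : (T : ℝ) ∈ Icc 0 (τ : ℝ) := ⟨T.coe_nonneg, NNReal.coe_le_coe.2 hTle⟩
  have hminIcc : ∀ t : ℝ≥0, ((min t T : ℝ≥0) : ℝ) ∈ Icc 0 (T : ℝ) := fun t =>
    ⟨(min t T).coe_nonneg, NNReal.coe_le_coe.2 (min_le_right t T)⟩
  have hY := hX.shift_scale T hl ha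
  set Y : ℝ≥0 → Ω' → ℝ := fun t ω => a ^ 2 * (X (T + l * t) ω - X T ω) with hYdef
  -- Here `X T` is the part to be averaged out: `X τ = (a ^ 2)⁻¹ * Y T + X T`.
  set g : ℝ → ℝ≥0∞ := fun y => ∫⁻ w, h ((a ^ 2)⁻¹ * y + w) ∂(P'.map (X T)) with hgdef
  have : IsProbabilityMeasure (P'.map (X T)) :=
    Measure.isProbabilityMeasure_map (hX.measurable _).aemeasurable
  have hH : Measurable (Function.uncurry fun y w : ℝ => h ((a ^ 2)⁻¹ * y + w)) :=
    hw.comp ((measurable_fst.const_mul _).add measurable_snd)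
  have hg : Measurable g := hH.lintegral_prod_right'
  have hmV := hY.measurable_path T
  have hpath : P.map (fun ω (t : ℝ≥0) => ξ (min t T : ℝ≥0) ω) =
      (P'.map fun ω (t : ℝ≥0) => Y (min t T) ω).withDensity fun x => g (x T) := by
    have hR : Measurable fun (x : ℝ≥0 → ℝ) (t : ℝ≥0) => a ^ 2 * (x (T + l * min t T) - x T) := by
      fun_prop
    have hind := IndepFun.of_measurable_comap (f' := fun ω (t : ℝ≥0) => Y (min t T) ω)
      (g' := X T)
      (HasIndepIncrements.indepFun_past_future hX.measurable hX.start hX.indep T).symm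
      (@measurable_pi_lambda _ _ _ (_) _ _ fun t =>
        ((measurable_pi_apply (X := fun _ : ℝ≥0 => ℝ) (l * min t T)).comp
          (comap_measurable fun ω (s : ℝ≥0) => X (T + s) ω - X T ω)).const_mul (a ^ 2)) (by
        have := (measurable_pi_apply (X := fun _ : ℝ≥0 => ℝ) T).comp
          (comap_measurable fun ω (s : ℝ≥0) => X (min s T) ω)
        simpa [Function.comp_def] using this)
    have htilt := map_withDensity_of_indepFun hmV (hX.measurable T) hind
      (y := fun x => x T) (by fun_prop) hH
    rw [← htilt]
    have h1 := congrArg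
      (Measure.map fun (x : ℝ≥0 → ℝ) (t : ℝ≥0) => a ^ 2 * (x (T + l * min t T) - x T)) hlaw
    rw [Measure.map_map hR hS.measurable_path, Measure.map_map hR (hX.measurable_path τ)] at h1
    have hmin : ∀ t : ℝ≥0, min (T + l * min t T) τ = T + l * min t T := fun t =>
      min_eq_left (by rw [← hTτ]; gcongr; exact min_le_right _ _)
    simp only [Function.comp_def, hmin, min_eq_left hTle] at h1
    convert! h1 using 3 with ω ω
    · funext t
      rw [hξ _ (hminIcc t)]
      push_cast
      rw [mul_sub, add_comm]
    · funext ω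
      simp only [min_self, hYdef]
      rw [inv_mul_cancel_left₀ ha2.ne', hTτ, sub_add_cancel]
  have hG : Measurable (Function.uncurry fun x z => (a ^ 2)⁻¹ *
      (stableHalfBridgeDensity (a * (c * l)) T ((l : ℝ)⁻¹ * τ) x z * p ((a ^ 2)⁻¹ * z))) :=
    ((measurable_stableHalfBridgeDensity _ _ _).mul
      (hS.density_measurable.comp (measurable_snd.const_mul _))).const_mul _
  refine hY.isStableHalfRandomBridge_integral hT hg hG (fun y z hz => ?_) (fun t ht => ?_) hpath
    (fun y hy => ?_) ?_ (fun ω t ht => ?_) fun ω t ht => ?_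
  · have h1 := stableHalfBridgeDensity_nonneg (c := a * (c * l)) (by positivity) T.coe_nonneg hTlτ y z
    have h2 := hS.density_nonneg ((a ^ 2)⁻¹ * z) (by positivity)
    positivity
  · rw [show ξ t = fun ω => a ^ 2 * S (l * t + T) ω - a ^ 2 * S T ω from funext (hξ t ht)]
    exact ((hS.measurable _ (hIcc t ht)).const_mul _).sub ((hS.measurable _ hTIcc).const_mul _)
  · have hGy : Measurable fun z => ENNReal.ofReal ((a ^ 2)⁻¹ *
        (stableHalfBridgeDensity (a * (c * l)) T ((l : ℝ)⁻¹ * τ) y z * p ((a ^ 2)⁻¹ * z))) :=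
      ENNReal.measurable_ofReal.comp (hG.comp measurable_prodMk_left)
    simp only [hgdef]
    rw [hX.lintegral_weight_add hT hw, ← lintegral_indicator measurableSet_Ioi,
      lintegral_eq_ofReal_mul_lintegral_comp_mul ha2 (hGy.indicator measurableSet_Ioi),
      ← lintegral_const_mul _ (by fun_prop), ← lintegral_const_mul' _ _ ENNReal.ofReal_ne_top]
    refine lintegral_congr fun v => ?_
    by_cases hv : 0 < v
    · rw [indicator_of_mem (by exact mul_pos ha2 hv), hh, bridgeWeight,
        ← ENNReal.ofReal_mul (stableHalfDensity_nonneg hc.le T.coe_nonneg _),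
        ← ENNReal.ofReal_mul (stableHalfDensity_nonneg (by positivity) T.coe_nonneg _),
        ← ENNReal.ofReal_mul ha2.le, stableHalfBridgeDensity]
      -- After the substitution `z = a ^ 2 * v`, scaling returns every density to activity `c`. The
      -- remaining time `l⁻¹ * τ - T` of the scaled bridge becomes `T`, because `τ = (1 + l) * T`:
      -- the complementary increment is `X T`.
      have e1 : a ^ 2 * v - y = a ^ 2 * (v - (a ^ 2)⁻¹ * y) := by field_simp
      have e2 : (l : ℝ) * ((l : ℝ)⁻¹ * τ - T) = T := by rw [mul_sub, hlτ, hTτ']; ring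
      have e3 : stableHalfDensity (a * (c * l)) ((l : ℝ)⁻¹ * τ - T) (a ^ 2 * v - y) =
          (a ^ 2)⁻¹ * stableHalfDensity c T (v - (a ^ 2)⁻¹ * y) := by
        rw [e1, stableHalfDensity_scale ha, stableHalfDensity_time_scale, e2]
      have e4 : stableHalfDensity (a * (c * l)) ((l : ℝ)⁻¹ * τ) (a ^ 2 * v) =
          (a ^ 2)⁻¹ * stableHalfDensity c τ v := by
        rw [stableHalfDensity_scale ha, stableHalfDensity_time_scale, hlτ]
      rw [e3, e4, inv_mul_cancel_left₀ ha2.ne']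
      have hpos := stableHalfDensity_pos hc (t := τ) (NNReal.coe_pos.2 (hT.trans_le hTle)) hv
      congr 1
      field_simp
    · rw [indicator_of_notMem (by
        rw [mem_Ioi, mul_pos_iff_of_pos_left ha2]; exact hv), hh,
        bridgeWeight_of_nonpos (not_lt.1 hv)]
      simp
  · refine ae_of_all _ fun ω => ?_
    rw [hξ 0 ⟨le_rfl, T.coe_nonneg⟩]
    simp
  · have hcts := hS.rightCts ω (l * t + T) ⟨(hIcc t ⟨ht.1, ht.2.le⟩).1, by
      rw [hTτ']; have := ht.2; gcongr⟩
    have hmaps : MapsTo (fun s : ℝ => l * s + T) (Ici t) (Ici (l * t + T)) := by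
      intro s hs
      have : t ≤ s := hs
      simp only [mem_Ici]
      gcongr
    have hcts' : ContinuousWithinAt (fun s : ℝ => a ^ 2 * S (l * s + T) ω - a ^ 2 * S T ω)
        (Ici t) t :=
      ((ContinuousWithinAt.comp (g := fun s => S s ω) (f := fun s : ℝ => l * s + T) hcts
        (Continuous.continuousWithinAt (by fun_prop)) hmaps).const_smul (a ^ 2)).sub
        continuousWithinAt_const
    refine hcts'.congr_of_eventuallyEq ?_ (hξ t ⟨ht.1, ht.2.le⟩ ω)
    filter_upwards [self_mem_nhdsWithin, mem_nhdsWithin_of_mem_nhds (Iio_mem_nhds ht.2)] with s hs hs'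
    exact hξ s ⟨ht.1.trans hs, hs'.le⟩ ω
  · obtain ⟨b, hb⟩ := hS.leftLim ω (l * t + T) ⟨by have := ht.1; positivity,
      (hIcc t ⟨ht.1.le, ht.2⟩).2⟩
    have hto : Tendsto (fun s : ℝ => l * s + T) (𝓝[<] t) (𝓝[<] (l * t + T)) := by
      refine tendsto_nhdsWithin_iff.2 ⟨Tendsto.mono_left (Continuous.tendsto (by fun_prop) t)
        nhdsWithin_le_nhds, ?_⟩
      filter_upwards [self_mem_nhdsWithin] with s hs
      have : s < t := hs
      simp only [mem_Iio]
      gcongr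
    refine ⟨a ^ 2 * b - a ^ 2 * S T ω, (((hb.comp hto).const_mul (a ^ 2)).sub_const _).congr' ?_⟩
    filter_upwards [self_mem_nhdsWithin, mem_nhdsWithin_of_mem_nhds (Ioi_mem_nhds ht.1)] with s hs hs'
    exact (hξ s ⟨hs'.le, (le_of_lt hs).trans ht.2⟩ ω).symm

end

/-! ### Increments share their sum in proportion to duration -/

/-- A nonnegative function that is additive on `[0, L]` is linear there. -/
theorem ENNReal.mul_eq_mul_of_additive {g : ℝ≥0 → ℝ≥0∞} {L r : ℝ≥0}
    (hadd : ∀ a b, a + b ≤ L → g (a + b) = g a + g b) (hr : 0 < r) (hrL : r ≤ L) :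
    (L : ℝ≥0∞) * g r = r * g L := by
  have hL : 0 < L := hr.trans_le hrL
  have hmono : ∀ a b, a ≤ b → b ≤ L → g a ≤ g b := by
    intro a b hab hb
    rw [← add_tsub_cancel_of_le hab, hadd _ _ (by rwa [add_tsub_cancel_of_le hab])]
    exact le_self_add
  have hsmul : ∀ (n : ℕ) (a : ℝ≥0), 0 < n → n * a ≤ L → g (n * a) = n * g a := by
    intro n a hn
    induction n, hn using Nat.le_induction with
    | base => simp
    | succ n hn ih =>
      intro h
      push_cast at h ⊢
      rw [add_mul, one_mul] at h ⊢
      rw [hadd _ _ h, ih (le_self_add.trans h), add_mul, one_mul]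
  -- Comparison of `s` with multiples of the grid step `L / n`; monotonicity follows from additivity
  -- and nonnegativity.
  have hgrid : ∀ s, s ≤ L → ∀ m n : ℕ, 0 < n → m * L ≤ n * s → m * g L ≤ n * g s := by
    intro s hs m n hn hmn
    rcases Nat.eq_zero_or_pos m with rfl | hm
    · simp
    have hn' : (0 : ℝ≥0) < n := by exact_mod_cast hn
    have h1 : g L = n * g (L / n) := by
      rw [← hsmul n _ hn (by rw [mul_div_cancel₀ _ hn'.ne']), mul_div_cancel₀ _ hn'.ne']
    have h2 : (m : ℝ≥0) * (L / n) ≤ s := by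
      rw [← mul_div_assoc, div_le_iff₀ hn', mul_comm s]; exact hmn
    rw [h1, mul_left_comm, ← hsmul m _ hm (h2.trans hs)]
    gcongr
    exact hmono _ _ h2 hs
  have hlow : ∀ s, 0 < s → s ≤ L → (s : ℝ≥0∞) * g L ≤ L * g s := by
    intro s hs hsL
    rcases eq_or_ne (g s) ∞ with hB | hB
    · rw [hB, ENNReal.mul_top (by exact_mod_cast hL.ne')]
      exact le_top
    -- Some multiple of `s` exceeds `L`, so finiteness of `g s` forces that of `g L`.
    have hA : g L ≠ ∞ := by
      obtain ⟨n, hn⟩ := exists_nat_ge (L / s)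
      have hn0 : 0 < n := by
        rcases Nat.eq_zero_or_pos n with rfl | h
        · have : 0 < L / s := by positivity
          simp only [Nat.cast_zero] at hn
          exact absurd hn this.not_ge
        · exact h
      have := hgrid s hsL 1 n hn0 (by rw [div_le_iff₀ hs] at hn; simpa using hn)
      rw [Nat.cast_one, one_mul] at this
      exact ne_top_of_le_ne_top (ENNReal.mul_ne_top (by simp) hB) this
    have hkey : ∀ n : ℕ, 0 < n → (s : ℝ) * (g L).toReal ≤
        L * (g s).toReal + L * (g L).toReal * (1 / (n : ℝ)) := by
      intro n hn
      have hn' : (0 : ℝ) < n := by exact_mod_cast hn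
      have hL' : (0 : ℝ) < L := hL
      set m := ⌊(n : ℝ) * s / L⌋₊ with hm
      have hm1 : (m : ℝ) * L ≤ n * s := by
        rw [← le_div_iff₀ hL']
        exact Nat.floor_le (by positivity)
      have hm2 : (n : ℝ) * s ≤ (m + 1) * L := by
        rw [← div_le_iff₀ hL']
        exact (Nat.lt_floor_add_one _).le
      have h := ENNReal.toReal_mono (ENNReal.mul_ne_top (by simp) hB)
        (hgrid s hsL m n hn (by exact_mod_cast hm1))
      simp only [ENNReal.toReal_mul, ENNReal.toReal_natCast] at h
      have hA0 : 0 ≤ (g L).toReal := ENNReal.toReal_nonneg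
      rw [mul_one_div, ← sub_le_iff_le_add', le_div_iff₀ hn']
      nlinarith [mul_le_mul_of_nonneg_right hm2 hA0, mul_le_mul_of_nonneg_left h hL'.le]
    have hlim : Tendsto (fun n : ℕ => (L : ℝ) * (g s).toReal + L * (g L).toReal * (1 / (n : ℝ))) atTop
        (𝓝 (L * (g s).toReal)) := by
      simpa using (tendsto_one_div_atTop_nhds_zero_nat.const_mul
        ((L : ℝ) * (g L).toReal)).const_add ((L : ℝ) * (g s).toReal)
    have hle := ge_of_tendsto hlim ((eventually_gt_atTop 0).mono hkey)
    rw [← ENNReal.toReal_le_toReal (ENNReal.mul_ne_top ENNReal.coe_ne_top hA)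
      (ENNReal.mul_ne_top ENNReal.coe_ne_top hB)]
    simpa [ENNReal.toReal_mul] using hle
  refine le_antisymm ?_ (hlow r hr hrL)
  rcases eq_or_ne (g L) ∞ with hA | hA
  · rw [hA, ENNReal.mul_top (by exact_mod_cast hr.ne')]
    exact le_top
  rcases hrL.eq_or_lt with rfl | hlt
  · rfl
  have hsum : g L = g r + g (L - r) := by
    rw [← hadd _ _ (by rw [add_tsub_cancel_of_le hrL]), add_tsub_cancel_of_le hrL]
  -- The reverse inequality is the lower bound for the complement `L - r`, combined with additivity.
  have h2 := hlow (L - r) (tsub_pos_of_lt hlt) tsub_le_self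
  have hfin : ((L - r : ℝ≥0) : ℝ≥0∞) * g L ≠ ∞ := ENNReal.mul_ne_top ENNReal.coe_ne_top hA
  refine (ENNReal.add_le_add_iff_right hfin).1 ?_
  calc (L : ℝ≥0∞) * g r + ((L - r : ℝ≥0) : ℝ≥0∞) * g L ≤ L * g r + L * g (L - r) := by gcongr
    _ = ((r + (L - r) : ℝ≥0) : ℝ≥0∞) * g L := by
        rw [← mul_add, ← hsum, add_tsub_cancel_of_le hrL]
    _ = r * g L + ((L - r : ℝ≥0) : ℝ≥0∞) * g L := by rw [ENNReal.coe_add, add_mul]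

namespace IsStableHalfSubordinator

variable {Ω : Type*} [MeasurableSpace Ω] {c : ℝ} {X : ℝ≥0 → Ω → ℝ} {P : Measure Ω}
  [IsProbabilityMeasure P]

theorem isProbabilityMeasure_map (hX : IsStableHalfSubordinator c X P) (t : ℝ≥0) :
    IsProbabilityMeasure (P.map (X t)) :=
  Measure.isProbabilityMeasure_map (hX.measurable t).aemeasurable

/-- The mean of an increment given the sum of two independent increments is proportional to its
duration. -/
theorem lintegral_proportional (hX : IsStableHalfSubordinator c X P) {F : ℝ → ℝ≥0∞}
    (hF : Measurable F) {a : ℝ≥0} (ha : 0 < a) (b : ℝ≥0) :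
    ((a + b : ℝ≥0) : ℝ≥0∞) *
        ∫⁻ x, ∫⁻ y, ENNReal.ofReal x * F (x + y) ∂(P.map (X b)) ∂(P.map (X a)) =
      a * ∫⁻ z, ENNReal.ofReal z * F z ∂(P.map (X (a + b))) := by
  have hprob := hX.isProbabilityMeasure_map
  set G : ℝ≥0 → ℝ≥0 → ℝ≥0∞ := fun a b =>
    ∫⁻ x, ∫⁻ y, ENNReal.ofReal x * F (x + y) ∂(P.map (X b)) ∂(P.map (X a)) with hG
  have hG0 : ∀ a, G a 0 = ∫⁻ z, ENNReal.ofReal z * F z ∂(P.map (X a)) := by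
    intro a
    refine lintegral_congr fun x => ?_
    rw [lintegral_map (by fun_prop) (hX.measurable 0)]
    simp [hX.start]
  -- Split the weighted increment as `x + x'`. In each of the two terms the unweighted piece joins
  -- the remainder, and the argument of `F` is unchanged. With the total duration fixed, `G` is thus
  -- additive in the weighted duration.
  have hadd : ∀ a a' b, G (a + a') b = G a (a' + b) + G a' (a + b) := by
    intro a a' b
    have hK : Measurable fun z => ∫⁻ y, ENNReal.ofReal z * F (z + y) ∂(P.map (X b)) :=
      Measurable.lintegral_prod_right' (f := fun q : ℝ × ℝ => ENNReal.ofReal q.1 * F (q.1 + q.2))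
        (by fun_prop)
    have h1 : G a (a' + b) = ∫⁻ x, ∫⁻ x', ∫⁻ y, ENNReal.ofReal x * F (x + x' + y)
        ∂(P.map (X b)) ∂(P.map (X a')) ∂(P.map (X a)) := by
      refine lintegral_congr fun x => ?_
      rw [hX.lintegral_map_add a' b (by fun_prop)]
      simp only [add_assoc]
    have h2 : G a' (a + b) = ∫⁻ x, ∫⁻ x', ∫⁻ y, ENNReal.ofReal x' * F (x + x' + y)
        ∂(P.map (X b)) ∂(P.map (X a')) ∂(P.map (X a)) := by
      rw [lintegral_lintegral_swap (Measurable.aemeasurable (Measurable.lintegral_prod_right'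
        (f := fun q : (ℝ × ℝ) × ℝ => ENNReal.ofReal q.1.2 * F (q.1.1 + q.1.2 + q.2))
        (by fun_prop)))]
      refine lintegral_congr fun x => ?_
      rw [hX.lintegral_map_add a b (by fun_prop)]
      refine lintegral_congr fun x' => lintegral_congr fun y => ?_
      rw [← add_assoc, add_comm x x']
    rw [h1, h2, ← lintegral_add_left]
    · simp only [hG]
      rw [hX.lintegral_map_add a a' hK]
      refine lintegral_congr_ae ?_
      filter_upwards [hX.ae_nonneg_map a] with x hx
      rw [← lintegral_add_left]
      · refine lintegral_congr_ae ?_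
        filter_upwards [hX.ae_nonneg_map a'] with x' hx'
        rw [← lintegral_add_left (by fun_prop)]
        refine lintegral_congr fun y => ?_
        rw [ENNReal.ofReal_add hx hx', add_mul]
      · exact Measurable.lintegral_prod_right'
          (f := fun q : ℝ × ℝ => ENNReal.ofReal x * F (x + q.1 + q.2)) (by fun_prop)
    · exact Measurable.lintegral_prod_right' (f := fun q : ℝ × ℝ =>
        ∫⁻ y, ENNReal.ofReal q.1 * F (q.1 + q.2 + y) ∂(P.map (X b)))
        (Measurable.lintegral_prod_right'
          (f := fun q : (ℝ × ℝ) × ℝ => ENNReal.ofReal q.1.1 * F (q.1.1 + q.1.2 + q.2))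
          (by fun_prop))
  have := ENNReal.mul_eq_mul_of_additive (g := fun r => G r (a + b - r)) (L := a + b) (r := a)
    (fun r r' h => by
      rw [hadd]
      congr 2
      · rw [eq_tsub_iff_add_eq_of_le (le_self_add.trans h), add_right_comm, add_comm r' r,
          add_tsub_cancel_of_le h]
      · rw [eq_tsub_iff_add_eq_of_le (le_add_self.trans h), add_right_comm,
          add_tsub_cancel_of_le h]) ha le_self_add
  simpa [add_tsub_cancel_left, hG0] using this

end IsStableHalfSubordinator

/-- The joint law is a product of four marginals; Tonelli exchanges the two middle integrals. -/
theorem IndepFun.prodMk_prodMk_of_pair {Ω α β α' β' : Type*} [MeasurableSpace Ω] {P : Measure Ω}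
    [IsProbabilityMeasure P] [MeasurableSpace α] [MeasurableSpace β] [MeasurableSpace α']
    [MeasurableSpace β'] {f : Ω → α} {f' : Ω → α'} {g : Ω → β} {g' : Ω → β'} (hf : Measurable f)
    (hf' : Measurable f') (hg : Measurable g) (hg' : Measurable g')
    (h : IndepFun (fun ω => (f ω, f' ω)) (fun ω => (g ω, g' ω)) P) (hff : IndepFun f f' P)
    (hgg : IndepFun g g' P) :
    IndepFun (fun ω => (f ω, g ω)) (fun ω => (f' ω, g' ω)) P := by
  have h1 : IndepFun f g P := h.comp measurable_fst measurable_fst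
  have h2 : IndepFun f' g' P := h.comp measurable_snd measurable_snd
  rw [indepFun_iff_map_prod_eq_prod_map_map (by fun_prop) (by fun_prop)] at h hff hgg h1 h2 ⊢
  rw [h1, h2]
  rw [hff, hgg] at h
  have i1 := Measure.isProbabilityMeasure_map (μ := P) hf.aemeasurable
  have i2 := Measure.isProbabilityMeasure_map (μ := P) hf'.aemeasurable
  have i3 := Measure.isProbabilityMeasure_map (μ := P) hg.aemeasurable
  have i4 := Measure.isProbabilityMeasure_map (μ := P) hg'.aemeasurable
  refine Measure.ext_of_lintegral _ fun F hF => ?_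
  have e := congrArg (fun μ => ∫⁻ q, F ((q.1.1, q.2.1), (q.1.2, q.2.2)) ∂μ) h
  rw [lintegral_map (by fun_prop) (by fun_prop)] at e
  rw [lintegral_map hF (by fun_prop)]
  refine e.trans ?_
  rw [lintegral_prod _ (by fun_prop), lintegral_prod _ (by fun_prop), lintegral_prod _ (by fun_prop),
    lintegral_prod _ (by fun_prop)]
  refine lintegral_congr fun x => ?_
  have e1 : ∀ x', ∫⁻ q, F ((x, q.1), (x', q.2)) ∂((P.map g).prod (P.map g')) =
      ∫⁻ z, ∫⁻ z', F ((x, z), (x', z')) ∂(P.map g') ∂(P.map g) := fun x' =>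
    lintegral_prod _ (by fun_prop)
  have e2 : ∀ z, ∫⁻ q, F ((x, z), q) ∂((P.map f').prod (P.map g')) =
      ∫⁻ x', ∫⁻ z', F ((x, z), (x', z')) ∂(P.map g') ∂(P.map f') := fun x' =>
    lintegral_prod _ (by fun_prop)
  simp only [e1, e2]
  exact lintegral_lintegral_swap (Measurable.aemeasurable (Measurable.lintegral_prod_right'
    (f := fun q : (α' × β) × β' => F ((x, q.1.2), (q.1.1, q.2))) (by fun_prop)))

namespace IsStableHalfSubordinator

variable {Ω : Type*} [MeasurableSpace Ω] {c : ℝ} {X : ℝ≥0 → Ω → ℝ} {P : Measure Ω}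
  [IsProbabilityMeasure P]

/-- Cutting at `T`, then the first block at `t` and the second at `T + s`, gives four independent
pieces. They are regrouped as the observed history and the two unobserved gaps. -/
theorem indepFun_history_increments (hX : IsStableHalfSubordinator c X P) {t T s τ : ℝ≥0}
    (htT : t ≤ T) (hsτ : T + s ≤ τ) :
    IndepFun (fun ω => (fun r : ℝ≥0 => X (min r t) ω, fun r : ℝ≥0 => X (T + min r s) ω - X T ω))
      (fun ω => (X T ω - X t ω, X τ ω - X (T + s) ω)) P ∧
    IndepFun (fun ω => X T ω - X t ω) (fun ω => X τ ω - X (T + s) ω) P := by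
  have hT := HasIndepIncrements.indepFun_past_future hX.measurable hX.start hX.indep T
  have ht := HasIndepIncrements.indepFun_past_future hX.measurable hX.start hX.indep t
  have hY : IsStableHalfSubordinator c (fun r ω => X (T + r) ω - X T ω) P := by
    simpa using hX.shift_scale T one_pos one_pos
  have hs := HasIndepIncrements.indepFun_past_future hY.measurable hY.start hY.indep s
  have hpast : ∀ r : ℝ≥0, Measurable[MeasurableSpace.pi.comap fun ω (s : ℝ≥0) => X (min s T) ω]
      (X (min r T)) := fun r => (measurable_pi_apply (X := fun _ : ℝ≥0 => ℝ) r).comp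
        (comap_measurable fun ω (s : ℝ≥0) => X (min s T) ω)
  have hfut : ∀ r : ℝ≥0, Measurable[MeasurableSpace.pi.comap fun ω (s : ℝ≥0) => X (T + s) ω - X T ω]
      (fun ω => X (T + r) ω - X T ω) := fun r => (measurable_pi_apply (X := fun _ : ℝ≥0 => ℝ) r).comp
        (comap_measurable fun ω (s : ℝ≥0) => X (T + s) ω - X T ω)
  have hmV₂ : Measurable fun ω (r : ℝ≥0) => X (T + min r s) ω - X T ω :=
    measurable_pi_lambda _ fun r => hX.measurable_sub _ _
  have hτ : T + (τ - T) = τ := add_tsub_cancel_of_le (le_self_add.trans hsτ)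
  have hpair : IndepFun (fun ω => (fun r : ℝ≥0 => X (min r t) ω, X T ω - X t ω))
      (fun ω => (fun r : ℝ≥0 => X (T + min r s) ω - X T ω, X τ ω - X (T + s) ω)) P := by
    refine IndepFun.of_measurable_comap hT ?_ ?_
    · refine @Measurable.prodMk _ _ _ _ _ (_) _ _ (@measurable_pi_lambda _ _ _ (_) _ _ fun r => ?_) ?_
      · simpa [min_assoc, htT] using hpast (min r t)
      · have := (hpast T).sub (hpast t)
        rwa [min_self, min_eq_left htT] at this
    · refine @Measurable.prodMk _ _ _ _ _ (_) _ _ (@measurable_pi_lambda _ _ _ (_) _ _ fun r => ?_) ?_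
      · exact hfut (min r s)
      · have := (hfut (τ - T)).sub (hfut s)
        rw [hτ] at this
        convert! this using 2 with ω
        simp
  have h1 : IndepFun (fun ω (r : ℝ≥0) => X (min r t) ω) (fun ω => X T ω - X t ω) P := by
    refine IndepFun.of_measurable_comap ht (comap_measurable _) ?_
    have := (measurable_pi_apply (X := fun _ : ℝ≥0 => ℝ) (T - t)).comp
      (comap_measurable fun ω (s : ℝ≥0) => X (t + s) ω - X t ω)
    simpa [Function.comp_def, add_tsub_cancel_of_le htT] using this
  have h2 : IndepFun (fun ω (r : ℝ≥0) => X (T + min r s) ω - X T ω)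
      (fun ω => X τ ω - X (T + s) ω) P := by
    refine IndepFun.of_measurable_comap hs (comap_measurable _) ?_
    have := (measurable_pi_apply (X := fun _ : ℝ≥0 => ℝ) (τ - (T + s))).comp
      (comap_measurable fun ω (r : ℝ≥0) => X (T + (s + r)) ω - X T ω - (X (T + s) ω - X T ω))
    simpa [Function.comp_def, ← add_assoc, add_tsub_cancel_of_le hsτ] using this
  exact ⟨IndepFun.prodMk_prodMk_of_pair (hX.measurable_path t) (hX.measurable_sub _ _) hmV₂
    (hX.measurable_sub _ _) hpair h1 h2, hpair.comp measurable_snd measurable_snd⟩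

end IsStableHalfSubordinator

/-! ### The posterior density -/

section posterior

variable {Ω : Type*} [MeasurableSpace Ω] {c : ℝ} {X : ℝ≥0 → Ω → ℝ} {P : Measure Ω}
  {p : ℝ → ℝ}

theorem measurable_posteriorWeight (c Tstar u : ℝ) (hp : Measurable p) :
    Measurable (Function.uncurry (posteriorWeight c Tstar p u)) := by
  unfold posteriorWeight Function.uncurry
  refine Measurable.ite (measurableSet_lt measurable_fst measurable_snd) ?_ measurable_const
  fun_prop

theorem posteriorWeight_nonneg (hp : ∀ z, 0 < z → 0 ≤ p z) (c Tstar u : ℝ) {y z : ℝ} (hz : 0 < z) :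
    0 ≤ posteriorWeight c Tstar p u y z := by
  unfold posteriorWeight
  split_ifs with h
  · have h1 := hp z hz
    have h2 : 0 < z - y := sub_pos.2 h
    positivity
  · exact le_rfl

/-- The explicit weight is the likelihood of the remaining increment times `p / f_τ`, up to the
constant `τ / (τ - u)`, which normalisation removes. -/
theorem posteriorWeight_eq (hc : 0 < c) {u τ : ℝ} (huτ : u < τ) (hτ : 0 < τ) {y z : ℝ}
    (hz : 0 < z) :
    posteriorWeight c τ p u y z =
      τ / (τ - u) * (stableHalfDensity c (τ - u) (z - y) * (p z / stableHalfDensity c τ z)) := by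
  unfold posteriorWeight
  have hσ : 0 < τ - u := sub_pos.2 huτ
  by_cases hyz : y < z
  · have hzy : 0 < z - y := sub_pos.2 hyz
    rw [if_pos hyz, stableHalfDensity, stableHalfDensity, if_pos hzy, if_pos hz,
      Real.div_rpow hz.le hzy.le]
    have he : Real.exp (-(c ^ 2 / 2) * ((τ - u) ^ 2 / (z - y) - τ ^ 2 / z)) =
        Real.exp (-(1 / 2) * (c ^ 2 * (τ - u) ^ 2 / (z - y))) /
          Real.exp (-(1 / 2) * (c ^ 2 * τ ^ 2 / z)) := by
      rw [← Real.exp_sub]; congr 1; ring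
    rw [he]
    have : (0 : ℝ) < z ^ (3 / 2 : ℝ) := by positivity
    have : (0 : ℝ) < (z - y) ^ (3 / 2 : ℝ) := by positivity
    have := Real.exp_pos (-(1 / 2) * (c ^ 2 * τ ^ 2 / z))
    have : 0 < √(2 * Real.pi) := by positivity
    field_simp
  · rw [if_neg hyz, stableHalfDensity_of_nonpos (sub_nonpos.2 (not_lt.1 hyz))]
    simp

/-- Integrals against the posterior weight are integrals against the law of the remaining
increment. -/
theorem IsStableHalfSubordinator.lintegral_posteriorWeight (hX : IsStableHalfSubordinator c X P)
    (hc : 0 < c) {u τ : ℝ≥0} (huτ : u < τ) (hp : Measurable p) {k : ℝ → ℝ≥0∞} (hk : Measurable k)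
    (y : ℝ) :
    ∫⁻ z in Ioi 0, k z * ENNReal.ofReal (posteriorWeight c τ p u y z) =
      ENNReal.ofReal (τ / (τ - u)) *
        ∫⁻ w, k (y + w) * bridgeWeight c τ p (y + w) ∂(P.map (X (τ - u))) := by
  have huτ' : (u : ℝ) < τ := huτ
  have hτ : (0 : ℝ) < τ := u.coe_nonneg.trans_lt huτ'
  have hσ : (0 : ℝ) < τ - u := sub_pos.2 huτ'
  have hw := measurable_bridgeWeight c τ hp
  rw [hX.lintegral_weight_add (h := fun z => k z * bridgeWeight c τ p z) (tsub_pos_of_lt huτ)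
    (by fun_prop), ← lintegral_indicator measurableSet_Ioi,
    ← lintegral_const_mul' _ _ ENNReal.ofReal_ne_top]
  refine lintegral_congr fun z => ?_
  by_cases hz : 0 < z
  · rw [indicator_of_mem (by exact hz), posteriorWeight_eq hc huτ' hτ hz,
      ENNReal.ofReal_mul (by positivity),
      ENNReal.ofReal_mul (stableHalfDensity_nonneg hc.le hσ.le _), bridgeWeight, NNReal.coe_sub huτ.le]
    ring
  · rw [indicator_of_notMem (by exact hz), bridgeWeight_of_nonpos (not_lt.1 hz)]
    simp

/-- The mean of the posterior density. -/
noncomputable def posteriorMean (c Tstar : ℝ) (p : ℝ → ℝ) (u y : ℝ) : ℝ :=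
  ∫ z in Ioi 0, z * posteriorDensity c Tstar p u y z

theorem measurable_posteriorMean (c Tstar u : ℝ) (hp : Measurable p) :
    Measurable (posteriorMean c Tstar p u) := by
  have hw := measurable_posteriorWeight c Tstar u hp
  have h1 : Measurable fun y => ∫ v in Ioi 0, posteriorWeight c Tstar p u y v :=
    (StronglyMeasurable.integral_prod_right' hw.stronglyMeasurable).measurable
  have h2 : Measurable fun q : ℝ × ℝ => q.2 * posteriorDensity c Tstar p u q.1 q.2 :=
    measurable_snd.mul ((h1.comp measurable_fst).inv.mul hw)
  exact (StronglyMeasurable.integral_prod_right' h2.stronglyMeasurable).measurable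

/-- The mass of the likelihood of the remaining increment. -/
noncomputable def evidence (c τ : ℝ) (p : ℝ → ℝ) (ν : Measure ℝ) (y : ℝ) : ℝ≥0∞ :=
  ∫⁻ w, bridgeWeight c τ p (y + w) ∂ν

/-- The first moment of the terminal value against the likelihood of the remaining increment. -/
noncomputable def evidenceMoment (c τ : ℝ) (p : ℝ → ℝ) (ν : Measure ℝ) (y : ℝ) : ℝ≥0∞ :=
  ∫⁻ w, bridgeWeight c τ p (y + w) * ENNReal.ofReal (y + w) ∂ν

/-- The posterior mean is the ratio of `evidenceMoment` to `evidence`; the bounds on these two make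
the Bochner integrals genuine. -/
theorem IsStableHalfSubordinator.posterior_facts (hX : IsStableHalfSubordinator c X P)
    (hc : 0 < c) {u τ : ℝ≥0} (huτ : u < τ) (hp : Measurable p) (hp0 : ∀ z, 0 < z → 0 ≤ p z) {y : ℝ}
    (hZ0 : evidence c τ p (P.map (X (τ - u))) y ≠ 0)
    (hZ : evidence c τ p (P.map (X (τ - u))) y ≠ ∞)
    (hN : evidenceMoment c τ p (P.map (X (τ - u))) y ≠ ∞) :
    ∫ z in Ioi 0, posteriorDensity c τ p u y z = 1 ∧
    IntegrableOn (fun z => z * posteriorDensity c τ p u y z) (Ioi 0) ∧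
    ENNReal.ofReal (posteriorMean c τ p u y) * evidence c τ p (P.map (X (τ - u))) y =
      evidenceMoment c τ p (P.map (X (τ - u))) y := by
  set Z := evidence c τ p (P.map (X (τ - u))) y with hZdef
  set N := evidenceMoment c τ p (P.map (X (τ - u))) y with hNdef
  have huτ' : (u : ℝ) < τ := huτ
  have hτ : (0 : ℝ) < τ := u.coe_nonneg.trans_lt huτ'
  have hσ : (0 : ℝ) < τ - u := sub_pos.2 huτ'
  have hr : 0 < (τ : ℝ) / (τ - u) := by positivity
  have hwm : Measurable (posteriorWeight c τ p u y) :=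
    (measurable_posteriorWeight c τ u hp).comp measurable_prodMk_left
  have hw0 : 0 ≤ᵐ[volume.restrict (Ioi 0)] posteriorWeight c τ p u y :=
    (ae_restrict_iff' measurableSet_Ioi).2 (ae_of_all _ fun z hz => posteriorWeight_nonneg hp0 c τ u hz)
  have hzw0 : 0 ≤ᵐ[volume.restrict (Ioi 0)] fun z => z * posteriorWeight c τ p u y z :=
    (ae_restrict_iff' measurableSet_Ioi).2 (ae_of_all _ fun z hz =>
      mul_nonneg (le_of_lt hz) (posteriorWeight_nonneg hp0 c τ u hz))
  have h1 : ∫⁻ z in Ioi 0, ENNReal.ofReal (posteriorWeight c τ p u y z) =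
      ENNReal.ofReal (τ / (τ - u)) * Z := by
    simpa [hZdef, evidence] using hX.lintegral_posteriorWeight hc huτ hp (k := fun _ => 1) measurable_const y
  have h2 : ∫⁻ z in Ioi 0, ENNReal.ofReal (z * posteriorWeight c τ p u y z) =
      ENNReal.ofReal (τ / (τ - u)) * N := by
    have := hX.lintegral_posteriorWeight hc huτ hp (k := fun z => ENNReal.ofReal z)
      ENNReal.measurable_ofReal y
    simp only [mul_comm (ENNReal.ofReal (y + _))] at this
    rw [hNdef, evidenceMoment, ← this]
    refine setLIntegral_congr_fun measurableSet_Ioi fun z hz => ?_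
    exact ENNReal.ofReal_mul (le_of_lt hz)
  have hA : ∫ z in Ioi 0, posteriorWeight c τ p u y z = τ / (τ - u) * Z.toReal := by
    rw [integral_eq_lintegral_of_nonneg_ae hw0 hwm.aestronglyMeasurable, h1, ENNReal.toReal_mul,
      ENNReal.toReal_ofReal hr.le]
  have hB : ∫ z in Ioi 0, z * posteriorWeight c τ p u y z = τ / (τ - u) * N.toReal := by
    rw [integral_eq_lintegral_of_nonneg_ae hzw0 (measurable_id.mul hwm).aestronglyMeasurable, h2,
      ENNReal.toReal_mul, ENNReal.toReal_ofReal hr.le]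
  have hBi : IntegrableOn (fun z => z * posteriorWeight c τ p u y z) (Ioi 0) := by
    refine ⟨(measurable_id.mul hwm).aestronglyMeasurable, ?_⟩
    rw [hasFiniteIntegral_iff_ofReal hzw0, h2]
    exact ENNReal.mul_lt_top ENNReal.ofReal_lt_top hN.lt_top
  have hZpos : 0 < Z.toReal := ENNReal.toReal_pos hZ0 hZ
  have hd : ∀ z, z * posteriorDensity c τ p u y z =
      (τ / (τ - u) * Z.toReal)⁻¹ * (z * posteriorWeight c τ p u y z) := fun z => by
    rw [posteriorDensity, hA]; ring
  refine ⟨?_, ?_, ?_⟩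
  · simp only [posteriorDensity]
    rw [integral_const_mul, hA, inv_mul_cancel₀ (by positivity)]
  · simp only [hd]
    exact hBi.const_mul _
  · rw [posteriorMean]
    simp only [hd]
    rw [integral_const_mul, hB]
    have : (τ / (τ - u) * Z.toReal)⁻¹ * (τ / (τ - u) * N.toReal) = N.toReal / Z.toReal := by
      field_simp
    rw [this, ENNReal.ofReal_div_of_pos hZpos, ENNReal.ofReal_toReal hN, ENNReal.ofReal_toReal hZ,
      ENNReal.div_mul_cancel hZ0 hZ]

end posterior

/-! ### Bayes' formula and conditional expectations -/

theorem condExp_ae_eq_const_mul_of_setLIntegral {Ω : Type*} {m m0 : MeasurableSpace Ω}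
    {P : Measure Ω} [IsProbabilityMeasure P] (hm : m ≤ m0) {f g : Ω → ℝ} (hf : Integrable f P)
    (hg : Integrable g P) (hf0 : 0 ≤ᵐ[P] f) (hg0 : 0 ≤ᵐ[P] g) {r : ℝ} (hr : 0 ≤ r)
    (h : ∀ A, MeasurableSet[m] A →
      ∫⁻ ω in A, ENNReal.ofReal (f ω) ∂P = ENNReal.ofReal r * ∫⁻ ω in A, ENNReal.ofReal (g ω) ∂P) :
    P[f | m] =ᵐ[P] fun ω => r * P[g | m] ω := by
  refine (ae_eq_condExp_of_forall_setIntegral_eq hm hf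
    (fun s _ _ => (integrable_condExp.const_mul r).integrableOn) (fun s hs _ => ?_)
    (stronglyMeasurable_condExp.const_mul r).aestronglyMeasurable).symm
  rw [integral_const_mul, setIntegral_condExp hm hg hs,
    integral_eq_lintegral_of_nonneg_ae (ae_restrict_of_ae hf0) hf.1.restrict,
    integral_eq_lintegral_of_nonneg_ae (ae_restrict_of_ae hg0) hg.1.restrict, h s hs,
    ENNReal.toReal_mul, ENNReal.toReal_ofReal hr]

/-- Transfer of expectations from a law tilted by a function of `y (V)` and an independent `D`. -/
theorem setLIntegral_of_map_eq_tilt {Ω Ω' E F G : Type*} [MeasurableSpace Ω] [MeasurableSpace Ω']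
    [MeasurableSpace E] [MeasurableSpace F] [MeasurableSpace G] {P : Measure Ω} {P' : Measure Ω'}
    [IsProbabilityMeasure P'] {Ψ : Ω → E} {W : Ω → G} {V : Ω' → E} {W' : Ω' → G} {D : Ω' → F}
    (hΨ : Measurable Ψ) (hW : Measurable W) (hV : Measurable V) (hW' : Measurable W')
    (hD : Measurable D) (hi : IndepFun V D P') {y : E → ℝ} (hy : Measurable y)
    {H K : ℝ → F → ℝ≥0∞} (hH : Measurable (Function.uncurry H))
    (hK : Measurable (Function.uncurry K))
    (hlaw : P.map (fun ω => (Ψ ω, W ω)) =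
      (P'.withDensity fun ω => H (y (V ω)) (D ω)).map fun ω => (V ω, W' ω))
    {k : G → ℝ≥0∞} (hk : Measurable k) (hkK : ∀ ω, k (W' ω) = K (y (V ω)) (D ω)) {B : Set E}
    (hB : MeasurableSet B) :
    ∫⁻ ω in Ψ ⁻¹' B, k (W ω) ∂P =
      ∫⁻ v in B, ∫⁻ d, H (y v) d * K (y v) d ∂(P'.map D) ∂(P'.map V) := by
  have hB' : MeasurableSet (Prod.fst ⁻¹' B : Set (E × G)) := measurable_fst hB
  have hk' : Measurable fun q : E × G => k q.2 := hk.comp measurable_snd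
  have hHD : Measurable fun ω => H (y (V ω)) (D ω) := hH.comp ((hy.comp hV).prodMk hD)
  have h1 : ∫⁻ ω in Ψ ⁻¹' B, k (W ω) ∂P =
      ∫⁻ q in Prod.fst ⁻¹' B, k q.2 ∂(P.map fun ω => (Ψ ω, W ω)) := by
    rw [setLIntegral_map hB' hk' (hΨ.prodMk hW)]; rfl
  have h2 : ∫⁻ ω in V ⁻¹' B, k (W' ω) ∂(P'.withDensity fun ω => H (y (V ω)) (D ω)) =
      ∫⁻ q in Prod.fst ⁻¹' B, k q.2
        ∂((P'.withDensity fun ω => H (y (V ω)) (D ω)).map fun ω => (V ω, W' ω)) := by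
    rw [setLIntegral_map hB' hk' (hV.prodMk hW')]; rfl
  rw [h1, hlaw, ← h2, setLIntegral_withDensity_eq_setLIntegral_mul _ hHD
    (show Measurable fun ω => k (W' ω) from hk.comp hW') (hV hB)]
  have h3 := congrArg (fun μ => μ B) (map_withDensity_of_indepFun hV hD hi hy
    (H := fun y d => H y d * K y d) (hH.mul hK))
  rw [Measure.map_apply hV hB, withDensity_apply _ (hV hB), withDensity_apply _ hB] at h3
  rw [← h3]
  refine lintegral_congr fun ω => ?_
  rw [Pi.mul_apply, hkK]

/-- Bayes' formula for the terminal value given an observation `Ψ` whose law is that of `V` under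
the tilted measure. -/
theorem IsStableHalfSubordinator.bayes {Ω : Type*} [MeasurableSpace Ω] {P : Measure Ω}
    [IsProbabilityMeasure P] {Ω' E : Type*} [MeasurableSpace Ω'] [MeasurableSpace E]
    {P' : Measure Ω'} [IsProbabilityMeasure P'] {c : ℝ} (hc : 0 < c) {X : ℝ≥0 → Ω' → ℝ}
    (hX : IsStableHalfSubordinator c X P') {u τ : ℝ≥0} (huτ : u < τ) {p : ℝ → ℝ} (hp : Measurable p)
    (hp0 : ∀ z, 0 < z → 0 ≤ p z) {Ψ : Ω → E} {Z : Ω → ℝ} {V : Ω' → E} {D : Ω' → ℝ} {y : E → ℝ}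
    (hΨ : Measurable Ψ) (hZ : Measurable Z) (hV : Measurable V) (hD : Measurable D)
    (hi : IndepFun V D P') (hy : Measurable y) (hDlaw : P'.map D = P'.map (X (τ - u)))
    (hXD : ∀ ω, X τ ω = y (V ω) + D ω) (hZi : Integrable Z P)
    (hlaw : P.map (fun ω => (Ψ ω, Z ω)) =
      (P'.withDensity (bridgeWeight c τ p ∘ X τ)).map fun ω => (V ω, X τ ω)) :
    P.map Ψ = (P'.map V).withDensity (fun v => evidence c τ p (P'.map (X (τ - u))) (y v)) ∧
    (∀ᵐ v ∂(P.map Ψ), ∫ z in Ioi 0, posteriorDensity c τ p u (y v) z = 1 ∧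
      IntegrableOn (fun z => z * posteriorDensity c τ p u (y v) z) (Ioi 0)) ∧
    ∀ B, MeasurableSet B → ∫⁻ ω in Ψ ⁻¹' B, ENNReal.ofReal (Z ω) ∂P =
      ∫⁻ ω in Ψ ⁻¹' B, ENNReal.ofReal (posteriorMean c τ p u (y (Ψ ω))) ∂P := by
  have hw := measurable_bridgeWeight c τ hp
  have := hX.isProbabilityMeasure_map (τ - u)
  have hH : Measurable (Function.uncurry fun y w : ℝ => bridgeWeight c τ p (y + w)) :=
    hw.comp (measurable_fst.add measurable_snd)
  have hK : Measurable (Function.uncurry fun y w : ℝ => ENNReal.ofReal (y + w)) :=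
    ENNReal.measurable_ofReal.comp (measurable_fst.add measurable_snd)
  have hev : Measurable (evidence c τ p (P'.map (X (τ - u)))) := hH.lintegral_prod_right'
  have hevy : Measurable fun v => evidence c τ p (P'.map (X (τ - u))) (y v) := hev.comp hy
  have hmom : Measurable (evidenceMoment c τ p (P'.map (X (τ - u)))) :=
    (hH.mul hK).lintegral_prod_right'
  have hlaw' : P.map (fun ω => (Ψ ω, Z ω)) =
      (P'.withDensity fun ω => bridgeWeight c τ p (y (V ω) + D ω)).map fun ω => (V ω, X τ ω) := by
    rw [hlaw]
    congr 2
    funext ω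
    rw [Function.comp_apply, hXD]
  have hmap : P.map Ψ =
      (P'.map V).withDensity (fun v => evidence c τ p (P'.map (X (τ - u))) (y v)) := by
    refine Measure.ext fun B hB => ?_
    have := setLIntegral_of_map_eq_tilt hΨ hZ hV (hX.measurable τ) hD hi hy hH
      (K := fun _ _ => 1) measurable_const hlaw' (k := fun _ => 1) measurable_const (fun _ => rfl) hB
    rw [Measure.map_apply hΨ hB, withDensity_apply _ hB]
    simpa [evidence, hDlaw] using this
  have hmoment : ∀ B, MeasurableSet B → ∫⁻ ω in Ψ ⁻¹' B, ENNReal.ofReal (Z ω) ∂P =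
      ∫⁻ v in B, evidenceMoment c τ p (P'.map (X (τ - u))) (y v) ∂(P'.map V) := by
    intro B hB
    have := setLIntegral_of_map_eq_tilt hΨ hZ hV (hX.measurable τ) hD hi hy hH hK hlaw'
      (k := ENNReal.ofReal) ENNReal.measurable_ofReal (fun ω => by rw [hXD]) hB
    simpa [evidenceMoment, hDlaw] using this
  have hfin1 : ∀ᵐ v ∂(P'.map V), evidence c τ p (P'.map (X (τ - u))) (y v) ≠ ∞ := by
    have : ∫⁻ v, evidence c τ p (P'.map (X (τ - u))) (y v) ∂(P'.map V) ≠ ∞ := by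
      have h1 := congrArg (fun μ => μ univ) hmap
      have : IsProbabilityMeasure (P.map Ψ) := Measure.isProbabilityMeasure_map hΨ.aemeasurable
      simp only [measure_univ, withDensity_apply _ MeasurableSet.univ, Measure.restrict_univ] at h1
      rw [← h1]
      simp
    filter_upwards [ae_lt_top hevy this] with v hv using hv.ne
  have hfin2 : ∀ᵐ v ∂(P'.map V), evidenceMoment c τ p (P'.map (X (τ - u))) (y v) ≠ ∞ := by
    have : ∫⁻ v, evidenceMoment c τ p (P'.map (X (τ - u))) (y v) ∂(P'.map V) ≠ ∞ := by
      have h1 := hmoment univ MeasurableSet.univ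
      simp only [preimage_univ, Measure.restrict_univ] at h1
      rw [← h1]
      exact hZi.lintegral_lt_top.ne
    filter_upwards [ae_lt_top (hmom.comp hy) this] with v hv using hv.ne
  have hm := measurable_posteriorMean c τ u hp
  refine ⟨hmap, ?_, fun B hB => ?_⟩
  -- Points of zero evidence carry no mass under the law of `Ψ`, so they may be discarded.
  · rw [hmap, ae_withDensity_iff hevy]
    filter_upwards [hfin1, hfin2] with v h1 h2 h0
    obtain ⟨h3, h4, -⟩ := hX.posterior_facts hc huτ hp hp0 h0 h1 h2
    exact ⟨h3, h4⟩
  · have h1 : ∫⁻ ω in Ψ ⁻¹' B, ENNReal.ofReal (posteriorMean c τ p u (y (Ψ ω))) ∂P =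
        ∫⁻ v in B, ENNReal.ofReal (posteriorMean c τ p u (y v)) ∂(P.map Ψ) := by
      rw [setLIntegral_map hB (by fun_prop) hΨ]
    rw [h1, hmoment B hB, hmap, setLIntegral_withDensity_eq_setLIntegral_mul _ hevy
      (by fun_prop) hB]
    refine lintegral_congr_ae (ae_restrict_of_ae ?_)
    filter_upwards [hfin1, hfin2] with v h2 h3
    rw [Pi.mul_apply]
    -- Where the evidence vanishes the posterior is undefined, but the weight is then almost
    -- everywhere zero and the moment vanishes too.
    by_cases h0 : evidence c τ p (P'.map (X (τ - u))) (y v) = 0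
    · rw [h0, zero_mul, evidenceMoment]
      have h4 : Measurable fun w => bridgeWeight c τ p (y v + w) := hH.comp measurable_prodMk_left
      rw [evidence, lintegral_eq_zero_iff h4] at h0
      rw [lintegral_eq_zero_iff (by fun_prop)]
      filter_upwards [h0] with w hw0
      simp only [Pi.zero_apply] at hw0 ⊢
      rw [hw0, zero_mul]
    · rw [mul_comm, (hX.posterior_facts hc huτ hp hp0 h0 h2 h3).2.2]

/-- The conditional expectation of the terminal value is the posterior mean. -/
theorem condExp_ae_eq_posteriorMean {Ω E : Type*} {m mΩ : MeasurableSpace Ω} {P : Measure Ω}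
    [IsProbabilityMeasure P] [MeasurableSpace E] {c Tstar u : ℝ} {p : ℝ → ℝ}
    (hp0 : ∀ z, 0 < z → 0 ≤ p z) (hp : Measurable p) {Ψ : Ω → E} {Z : Ω → ℝ} {Y : Ω → ℝ}
    (hZi : Integrable Z P) (hZ0 : 0 ≤ᵐ[P] Z) (hmΨ : m ≤ MeasurableSpace.comap Ψ inferInstance)
    (hm : m ≤ mΩ) (hY : Measurable[m] Y)
    (h : ∀ B, MeasurableSet B → ∫⁻ ω in Ψ ⁻¹' B, ENNReal.ofReal (Z ω) ∂P =
      ∫⁻ ω in Ψ ⁻¹' B, ENNReal.ofReal (posteriorMean c Tstar p u (Y ω)) ∂P) :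
    P[Z | m] =ᵐ[P] fun ω => posteriorMean c Tstar p u (Y ω) := by
  have hnn : ∀ y, 0 ≤ posteriorMean c Tstar p u y := fun y =>
    setIntegral_nonneg measurableSet_Ioi fun z hz => mul_nonneg (le_of_lt hz) <|
      mul_nonneg (inv_nonneg.2 (setIntegral_nonneg measurableSet_Ioi fun v hv =>
        posteriorWeight_nonneg hp0 c Tstar u hv)) (posteriorWeight_nonneg hp0 c Tstar u hz)
  have hgm : Measurable[m] fun ω => posteriorMean c Tstar p u (Y ω) :=
    (measurable_posteriorMean c Tstar u hp).comp hY
  have hgi : Integrable (fun ω => posteriorMean c Tstar p u (Y ω)) P := by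
    refine ⟨(hgm.mono hm le_rfl).aestronglyMeasurable, ?_⟩
    rw [hasFiniteIntegral_iff_ofReal (ae_of_all _ fun ω => hnn _)]
    have h1 := h univ MeasurableSet.univ
    simp only [preimage_univ, Measure.restrict_univ] at h1
    rw [← h1]
    exact hZi.lintegral_lt_top
  have := condExp_ae_eq_const_mul_of_setLIntegral hm hZi hgi hZ0 (ae_of_all _ fun ω => hnn _)
    zero_le_one (fun A hA => by
      obtain ⟨B, hB, rfl⟩ := hmΨ A hA
      rw [h B hB, ENNReal.ofReal_one, one_mul])
  rw [condExp_of_stronglyMeasurable hm hgm.stronglyMeasurable hgi] at this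
  simpa using this

/-- A conditional expectation given a larger σ-algebra that is a function of `X` is the conditional
mean given `X`. -/
theorem condMeanGiven_ae_eq {Ω E : Type*} {m mΩ : MeasurableSpace Ω} [MeasurableSpace E]
    {P : Measure Ω} [IsProbabilityMeasure P] {X : Ω → E} {Z : Ω → ℝ} (hX : Measurable X)
    (hZ : Integrable Z P) {g : E → ℝ} (hg : Measurable g)
    (hXm : MeasurableSpace.comap X inferInstance ≤ m) (hm : m ≤ mΩ)
    (h : P[Z | m] =ᵐ[P] fun ω => g (X ω)) :
    (∀ᵐ x ∂(P.map X), condMeanGiven Z X P x = g x) ∧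
      P[Z | m] =ᵐ[P] fun ω => condMeanGiven Z X P (X ω) := by
  have hcm : Measurable (condMeanGiven Z X P) :=
    (StronglyMeasurable.integral_condDistrib (f := fun q : E × ℝ => q.2)
      measurable_snd.stronglyMeasurable).measurable
  have hgi : Integrable (fun ω => g (X ω)) P := integrable_condExp.congr h
  have h1 : P[Z | MeasurableSpace.comap X inferInstance] =ᵐ[P] fun ω => g (X ω) := by
    have h2 := (condExp_congr_ae (m := MeasurableSpace.comap X inferInstance) h).symm.trans
      (condExp_condExp_of_le hXm hm)
    rw [condExp_of_stronglyMeasurable (f := fun ω => g (X ω)) hX.comap_le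
      (hg.comp (comap_measurable X)).stronglyMeasurable hgi] at h2
    exact h2.symm
  have h3 : (fun ω => condMeanGiven Z X P (X ω)) =ᵐ[P] fun ω => g (X ω) := by
    filter_upwards [h1, condExp_ae_eq_integral_condDistrib' hX hZ] with ω h4 h5
    rw [← h4, h5]
    rfl
  exact ⟨(ae_map_iff hX.aemeasurable (measurableSet_eq_fun hcm hg)).2 h3, h.trans h3.symm⟩

theorem IsStableHalfSubordinator.map_add_increment {Ω : Type*} [MeasurableSpace Ω] {P : Measure Ω}
    [IsProbabilityMeasure P] {c : ℝ} {X : ℝ≥0 → Ω → ℝ} (hX : IsStableHalfSubordinator c X P)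
    {s t : ℝ≥0} {A B : Ω → ℝ} (hA : Measurable A) (hB : Measurable B) (hi : IndepFun A B P)
    (hAs : P.map A = P.map (X s)) (hBt : P.map B = P.map (X t)) :
    P.map (fun ω => A ω + B ω) = P.map (X (s + t)) := by
  have := hX.isProbabilityMeasure_map t
  rw [indepFun_iff_map_prod_eq_prod_map_map hA.aemeasurable hB.aemeasurable, hAs, hBt] at hi
  refine Measure.ext_of_lintegral _ fun F hF => ?_
  rw [hX.lintegral_map_add s t hF, ← lintegral_prod (fun q : ℝ × ℝ => F (q.1 + q.2)) (by fun_prop),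
    ← hi, lintegral_map hF (by fun_prop), lintegral_map (by fun_prop) (by fun_prop)]

/-! ### Monotonicity and integrability of random bridges -/

section

variable {Ω : Type*} [MeasurableSpace Ω] {P : Measure Ω} [IsProbabilityMeasure P] {c : ℝ}
  {T τ : ℝ≥0} {p : ℝ → ℝ} {S : ℝ → Ω → ℝ}

namespace IsStableHalfRandomBridge

theorem measurable_coe (hS : IsStableHalfRandomBridge c τ p S P) {s : ℝ≥0} (hs : s ≤ τ) :
    Measurable (S s) :=
  hS.measurable _ ⟨s.coe_nonneg, NNReal.coe_le_coe.2 hs⟩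

/-- Monotone paths are not part of the definition of a bridge; the property is transferred from the
subordinator through the path law. -/
theorem ae_le (hS : IsStableHalfRandomBridge c τ p S P) (hc : 0 < c) (hτ : 0 < τ) {s s' : ℝ≥0}
    (hss : s ≤ s') (hs' : s' ≤ τ) : ∀ᵐ ω ∂P, S s ω ≤ S s' ω := by
  obtain ⟨Ω', m', P', hP', X, hX, hQ, hlaw⟩ := hS.exists_path_law hc hτ
  have h1 : ∀ᵐ x ∂(P.map (fun ω (t : ℝ≥0) => S (min t τ : ℝ≥0) ω)), x s ≤ x s' := by
    rw [hlaw, ae_map_iff (hX.measurable_path τ).aemeasurable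
      (measurableSet_le (measurable_pi_apply _) (measurable_pi_apply _))]
    exact ae_of_all _ fun ω => hX.mono ω (min_le_min_right τ hss)
  filter_upwards [ae_of_ae_map hS.measurable_path.aemeasurable h1] with ω hω
  simpa [min_eq_left hs', min_eq_left (hss.trans hs')] using hω

theorem ae_nonneg (hS : IsStableHalfRandomBridge c τ p S P) (hc : 0 < c) (hτ : 0 < τ) {s : ℝ≥0}
    (hs : s ≤ τ) : ∀ᵐ ω ∂P, 0 ≤ S s ω := by
  filter_upwards [hS.ae_le hc hτ zero_le hs, hS.start] with ω h1 h2
  simpa [h2] using h1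

theorem integrable (hS : IsStableHalfRandomBridge c τ p S P) (hc : 0 < c) (hτ : 0 < τ)
    (hint : Integrable (S τ) P) {s : ℝ≥0} (hs : s ≤ τ) : Integrable (S s) P := by
  refine hint.mono' (hS.measurable_coe hs).aestronglyMeasurable ?_
  filter_upwards [hS.ae_le hc hτ hs le_rfl, hS.ae_nonneg hc hτ hs] with ω h1 h2
  rwa [Real.norm_of_nonneg h2]

end IsStableHalfRandomBridge

end

/-! ### Conditional means given the joint history -/

/-- Conditional means given the joint history of the initial part and of the later increments of
a random bridge. -/
theorem IsStableHalfRandomBridge.condExp_joint_history {Ω : Type*} {m mΩ : MeasurableSpace Ω}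
    {P : Measure Ω} [IsProbabilityMeasure P] {c : ℝ} {T τ : ℝ≥0} {p : ℝ → ℝ} {S : ℝ → Ω → ℝ}
    (hS : IsStableHalfRandomBridge c τ p S P) (hc : 0 < c)
    (hint : Integrable (S τ) P) {t s : ℝ≥0} (htT : t < T) (hsτ : T + s ≤ τ) {Y : Ω → ℝ}
    (hY : Y = fun ω => S t ω + (S (T + s : ℝ≥0) ω - S T ω)) (hm : m ≤ mΩ)
    (hmle : m ≤ MeasurableSpace.comap (fun ω => (fun r : ℝ≥0 => S (min r t : ℝ≥0) ω,
      fun r : ℝ≥0 => S (T + min r s : ℝ≥0) ω - S T ω)) inferInstance) (hYm : Measurable[m] Y) :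
    (P[S τ | m] =ᵐ[P] (fun ω => posteriorMean c τ p (t + s : ℝ≥0) (Y ω)) ∧
      P[fun ω => S T ω - S t ω | m] =ᵐ[P] fun ω =>
        ((T : ℝ) - t) / (τ - (t + s)) * P[fun ω => S τ ω - Y ω | m] ω) ∧
    ∀ᵐ y ∂(P.map Y), (∫ z in Ioi 0, posteriorDensity c τ p (t + s : ℝ≥0) y z = 1 ∧
      IntegrableOn (fun z => z * posteriorDensity c τ p (t + s : ℝ≥0) y z) (Ioi 0)) ∧
      condMeanGiven (S τ) (S (t + s : ℝ≥0)) P y = posteriorMean c τ p (t + s : ℝ≥0) y := by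
  have hTτ : T ≤ τ := le_self_add.trans hsτ
  have htτ : t ≤ τ := htT.le.trans hTτ
  have hτ : 0 < τ := zero_le.trans_lt (htT.trans_le hTτ)
  have huτ : t + s < τ := (add_lt_add_left htT s).trans_le hsτ
  have hab : (T - t) + (τ - (T + s)) = τ - (t + s) := by
    refine (tsub_eq_of_eq_add ?_).symm
    rw [← NNReal.coe_inj]
    push_cast [NNReal.coe_sub htT.le, NNReal.coe_sub hsτ]
    ring
  have ha : 0 < T - t := tsub_pos_of_lt htT
  obtain ⟨Ω', m', P', hP', X, hX, hQ, hlaw⟩ := hS.exists_path_law hc hτ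
  have hw := measurable_bridgeWeight c τ hS.density_measurable
  have hprob := hX.isProbabilityMeasure_map
  have hR : ∀ {α : Type} [MeasurableSpace α] (R : (ℝ≥0 → ℝ) → α), Measurable R →
      P.map (fun ω => R fun r : ℝ≥0 => S (min r τ : ℝ≥0) ω) =
        (P'.withDensity (bridgeWeight c τ p ∘ X τ)).map fun ω => R fun r => X (min r τ) ω := by
    intro α _ R hR
    have h1 := congrArg (Measure.map R) hlaw
    rwa [Measure.map_map hR hS.measurable_path, Measure.map_map hR (hX.measurable_path τ)] at h1
  have hmin1 : ∀ r : ℝ≥0, min (min r t) τ = min r t := fun r =>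
    min_eq_left ((min_le_right r t).trans htτ)
  have hmin2 : ∀ r : ℝ≥0, min (T + min r s) τ = T + min r s := fun r =>
    min_eq_left (le_trans (by gcongr; exact min_le_right r s) hsτ)
  set Ψ : Ω → (ℝ≥0 → ℝ) × (ℝ≥0 → ℝ) := fun ω =>
    (fun r : ℝ≥0 => S (min r t : ℝ≥0) ω, fun r : ℝ≥0 => S (T + min r s : ℝ≥0) ω - S T ω) with hΨdef
  set V : Ω' → (ℝ≥0 → ℝ) × (ℝ≥0 → ℝ) := fun ω =>
    (fun r : ℝ≥0 => X (min r t) ω, fun r : ℝ≥0 => X (T + min r s) ω - X T ω) with hVdef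
  -- The total observed increment, the only feature of the history on which the weight depends.
  let y : (ℝ≥0 → ℝ) × (ℝ≥0 → ℝ) → ℝ := fun v => v.1 t + v.2 s
  have hy : Measurable y := by fun_prop
  have hyΨ : ∀ ω, y (Ψ ω) = Y ω := fun ω => by simp [y, hΨdef, hY]
  have hyV : ∀ ω, y (V ω) = X t ω + (X (T + s) ω - X T ω) := fun ω => by simp [y, hVdef]
  have hmΨ : Measurable Ψ := by
    refine Measurable.prodMk (measurable_pi_lambda _ fun r => ?_) (measurable_pi_lambda _ fun r => ?_)
    · exact hS.measurable_coe ((min_le_right r t).trans htτ)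
    · refine (hS.measurable_coe (le_trans ?_ hsτ)).sub (hS.measurable_coe hTτ)
      gcongr
      exact min_le_right r s
  have hmV : Measurable V := (hX.measurable_path t).prodMk
    (measurable_pi_lambda _ fun r => hX.measurable_sub _ _)
  have hmD₁ := hX.measurable_sub t T
  have hmD₂ := hX.measurable_sub (T + s) τ
  have hmD : Measurable fun ω => (X T ω - X t ω, X τ ω - X (T + s) ω) := hmD₁.prodMk hmD₂
  have hmY : Measurable Y := by
    rw [show Y = fun ω => y (Ψ ω) from funext fun ω => (hyΨ ω).symm]; exact hy.comp hmΨ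
  obtain ⟨hi, hiD⟩ := hX.indepFun_history_increments htT.le hsτ
  have hiDsum : IndepFun V (fun ω => (X T ω - X t ω) + (X τ ω - X (T + s) ω)) P' :=
    hi.comp measurable_id (measurable_fst.add measurable_snd)
  have hDsum : P'.map (fun ω => (X T ω - X t ω) + (X τ ω - X (T + s) ω)) =
      P'.map (X (τ - (t + s))) := by
    rw [← hab]
    exact hX.map_add_increment hmD₁ hmD₂ hiD (hX.map_sub htT.le) (hX.map_sub hsτ)
  have hXsum : ∀ ω, X τ ω = y (V ω) + ((X T ω - X t ω) + (X τ ω - X (T + s) ω)) := fun ω => by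
    rw [hyV]; ring
  have hSτ0 := hS.ae_nonneg hc hτ le_rfl
  have hp := hS.density_measurable
  have hp0 := hS.density_nonneg
  have hlawΨ : P.map (fun ω => (Ψ ω, S τ ω)) =
      (P'.withDensity (bridgeWeight c τ p ∘ X τ)).map fun ω => (V ω, X τ ω) := by
    have := hR (fun x => ((fun r : ℝ≥0 => x (min r t), fun r : ℝ≥0 => x (T + min r s) - x T), x τ))
      (by fun_prop)
    simpa only [hmin1, hmin2, min_self, min_eq_left hTτ] using this
  have hbayes := hX.bayes hc huτ hp hp0 hmΨ (hS.measurable_coe le_rfl) hmV (hmD₁.add hmD₂) hiDsum hy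
    hDsum hXsum hint hlawΨ
  refine ⟨⟨?_, ?_⟩, ?_⟩
  · exact condExp_ae_eq_posteriorMean hp0 hp hint hSτ0 hmle hm hYm fun B hB => by
      simpa only [hyΨ] using hbayes.2.2 B hB
  · have hSt := hS.integrable hc hτ hint htτ
    have hST := hS.integrable hc hτ hint hTτ
    have hSs := hS.integrable hc hτ hint hsτ
    have hYi : Integrable Y P := by rw [hY]; exact hSt.add (hSs.sub hST)
    have hr : 0 ≤ ((T : ℝ) - t) / (τ - (t + s)) := by
      have h1 : (t : ℝ) < T := htT
      have h2 : ((t + s : ℝ≥0) : ℝ) < τ := huτ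
      push_cast at h2
      exact div_nonneg (by linarith) (by linarith)
    refine condExp_ae_eq_const_mul_of_setLIntegral hm
      (f := fun ω => S T ω - S t ω) (g := fun ω => S τ ω - Y ω) (hST.sub hSt) (hint.sub hYi) ?_ ?_ hr
      fun A hA => ?_
    · filter_upwards [hS.ae_le hc hτ htT.le hTτ] with ω hω
      simpa using hω
    · filter_upwards [hS.ae_le hc hτ htT.le hTτ, hS.ae_le hc hτ hsτ le_rfl] with ω h1 h2
      simp only [Pi.zero_apply, hY]
      linarith
    obtain ⟨B, hB, rfl⟩ := hmle A hA
    have hlawW : P.map (fun ω => (Ψ ω, (S T ω - S t ω, S τ ω - Y ω))) =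
        (P'.withDensity fun ω => bridgeWeight c τ p (y (V ω) +
          ((X T ω - X t ω) + (X τ ω - X (T + s) ω)))).map
          fun ω => (V ω, (X T ω - X t ω, X τ ω - y (V ω))) := by
      have := hR (fun x => ((fun r : ℝ≥0 => x (min r t), fun r : ℝ≥0 => x (T + min r s) - x T),
        (x T - x t, x τ - (x t + (x (T + s) - x T))))) (by fun_prop)
      have hmin3 : min (T + s) τ = T + s := min_eq_left hsτ
      simp only [hmin1, hmin2, hmin3, min_self, min_eq_left hTτ, min_eq_left htτ] at this
      have hdens : (fun ω => bridgeWeight c τ p (y (V ω) +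
          ((X T ω - X t ω) + (X τ ω - X (T + s) ω)))) = bridgeWeight c τ p ∘ X τ :=
        funext fun ω => congrArg _ (hXsum ω).symm
      rw [hdens]
      simp only [hyV, hY]
      exact this
    have hW : Measurable fun ω => (S T ω - S t ω, S τ ω - Y ω) :=
      ((hS.measurable_coe hTτ).sub (hS.measurable_coe htτ)).prodMk
        ((hS.measurable_coe le_rfl).sub hmY)
    have hW' : Measurable fun ω => (X T ω - X t ω, X τ ω - y (V ω)) :=
      hmD₁.prodMk ((hX.measurable τ).sub (hy.comp hmV))
    have hH : Measurable (Function.uncurry fun (y : ℝ) (d : ℝ × ℝ) =>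
        bridgeWeight c τ p (y + (d.1 + d.2))) := hw.comp (by fun_prop)
    have h1 := setLIntegral_of_map_eq_tilt hmΨ hW hmV hW' hmD hi hy hH
      (K := fun _ d => ENNReal.ofReal d.1)
      (ENNReal.measurable_ofReal.comp (measurable_fst.comp measurable_snd)) hlawW
      (k := fun w => ENNReal.ofReal w.1) (by fun_prop) (fun ω => rfl) hB
    have h2 := setLIntegral_of_map_eq_tilt hmΨ hW hmV hW' hmD hi hy hH
      (K := fun _ d => ENNReal.ofReal (d.1 + d.2))
      (ENNReal.measurable_ofReal.comp
        ((measurable_fst.comp measurable_snd).add (measurable_snd.comp measurable_snd))) hlawW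
      (k := fun w => ENNReal.ofReal w.2) (by fun_prop) (fun ω =>
        congrArg ENNReal.ofReal (sub_eq_iff_eq_add'.2 (hXsum ω))) hB
    dsimp only at h1 h2
    rw [h1, h2, ← lintegral_const_mul' _ _ ENNReal.ofReal_ne_top]
    refine lintegral_congr fun v => ?_
    have hwv : Measurable fun z => bridgeWeight c τ p (y v + z) := hw.comp (by fun_prop)
    -- For a fixed history `v`, proportional sharing applies to the two gaps with the weight `h (y v
    -- + ·)` of their sum.
    have hprop := hX.lintegral_proportional hwv ha (τ - (T + s))
    rw [indepFun_iff_map_prod_eq_prod_map_map hmD₁.aemeasurable hmD₂.aemeasurable,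
      hX.map_sub htT.le, hX.map_sub hsτ] at hiD
    rw [hiD, lintegral_prod _ (by fun_prop), lintegral_prod _ (by fun_prop)]
    have h3 := hX.lintegral_map_add (T - t) (τ - (T + s))
      (F := fun z => bridgeWeight c τ p (y v + z) * ENNReal.ofReal z) (by fun_prop)
    dsimp only
    rw [← h3]
    simp only [mul_comm (bridgeWeight _ _ _ _)]
    have hpos : ((T - t + (τ - (T + s)) : ℝ≥0) : ℝ≥0∞) ≠ 0 := by
      rw [hab]; exact_mod_cast (tsub_pos_of_lt huτ).ne'
    have hratio : ENNReal.ofReal (((T : ℝ) - t) / (τ - (t + s))) =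
        ((T - t + (τ - (T + s)) : ℝ≥0) : ℝ≥0∞)⁻¹ * ((T - t : ℝ≥0) : ℝ≥0∞) := by
      rw [hab, ← NNReal.coe_sub htT.le, ← NNReal.coe_add, ← NNReal.coe_sub huτ.le, ← NNReal.coe_div,
        ENNReal.ofReal_coe_nnreal, ENNReal.coe_div (tsub_pos_of_lt huτ).ne', ENNReal.div_eq_inv_mul]
    rw [hratio, mul_assoc, ← hprop, ← mul_assoc, ENNReal.inv_mul_cancel hpos ENNReal.coe_ne_top,
      one_mul]
  · have hmyV : Measurable fun ω => y (V ω) := hy.comp hmV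
    have hlawY : P.map (fun ω => (Y ω, S τ ω)) =
        (P'.withDensity (bridgeWeight c τ p ∘ X τ)).map fun ω => (y (V ω), X τ ω) := by
      have := congrArg (Measure.map fun q : ((ℝ≥0 → ℝ) × (ℝ≥0 → ℝ)) × ℝ => (y q.1, q.2)) hlawΨ
      rw [Measure.map_map (by fun_prop) (hmΨ.prodMk (hS.measurable_coe le_rfl)),
        Measure.map_map (by fun_prop) (hmV.prodMk (hX.measurable τ))] at this
      simpa only [Function.comp_def, hyΨ] using this
    have hlawu : P.map (fun ω => (S (t + s : ℝ≥0) ω, S τ ω)) =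
        (P'.withDensity (bridgeWeight c τ p ∘ X τ)).map fun ω => (X (t + s) ω, X τ ω) := by
      have := hR (fun x => (x (t + s), x τ)) (by fun_prop)
      simpa only [min_self, min_eq_left huτ.le] using this
    -- Bayes' formula is applied to `Y` and to `S (t + s)`. The untilted counterparts have the same
    -- law and the evidence is the same function, so `Y` and `S (t + s)` are equal in law.
    -- Statements for almost every value of one therefore hold for the other.
    have hb1 := hX.bayes hc huτ hp hp0 hmY (hS.measurable_coe le_rfl) hmyV (hmD₁.add hmD₂)
      (hiDsum.comp hy measurable_id) measurable_id hDsum hXsum hint hlawY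
    have hb2 := hX.bayes hc huτ hp hp0 (hS.measurable_coe huτ.le) (hS.measurable_coe le_rfl)
      (hX.measurable (t + s)) (hX.measurable_sub (t + s) τ)
      (hX.indep.indepFun_eval_sub (r := 0) zero_le huτ.le (ae_of_all _ hX.start)) measurable_id
      (hX.map_sub huτ.le) (fun ω => by simp) hint hlawu
    have hYlaw : P'.map (fun ω => y (V ω)) = P'.map (X (t + s)) := by
      simp only [hyV]
      refine hX.map_add_increment (hX.measurable t) (hX.measurable_sub T (T + s)) ?_ rfl
        (hX.map_add_sub T s)
      have hVV := HasIndepIncrements.indepFun_past_future hX.measurable hX.start hX.indep T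
      have := hVV.comp (measurable_pi_apply t) (measurable_pi_apply s)
      simpa [Function.comp_def, min_eq_left htT.le] using this
    have hmapeq : P.map Y = P.map (S (t + s : ℝ≥0)) := by
      rw [hb1.1, hb2.1, hYlaw]
    have hmu := hS.measurable_coe huτ.le
    have hcm := (condMeanGiven_ae_eq hmu hint (measurable_posteriorMean c τ (t + s : ℝ≥0) hp) le_rfl
      hmu.comap_le (condExp_ae_eq_posteriorMean hp0 hp hint hSτ0 le_rfl hmu.comap_le
        (comap_measurable _) hb2.2.2)).1
    rw [← hmapeq] at hcm
    filter_upwards [hb1.2.1, hcm] with z h1 h2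
    exact ⟨h1, h2⟩

/-! ### The main theorem -/

theorem mainTheorem7 {Ω : Type*} [MeasurableSpace Ω] (P : Measure Ω) [IsProbabilityMeasure P]
    (c c₂ T Tstar lam k : ℝ) (hc : 0 < c) (hc₂ : 0 < c₂) (hT : 0 < T) (hTstar : T < Tstar)
    (hlam : lam = Tstar / T - 1) (hk : k = c₂ / (c * lam))
    (p : ℝ → ℝ) (S : ℝ → Ω → ℝ) (hS : IsStableHalfRandomBridge c Tstar p S P)
    (ξ₁ ξ₂ : ℝ → Ω → ℝ)
    (hξ₁ : ∀ t ∈ Icc 0 T, ∀ ω, ξ₁ t ω = S t ω)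
    (hξ₂ : ∀ t ∈ Icc 0 T, ∀ ω, ξ₂ t ω = k ^ 2 * S (lam * t + T) ω - k ^ 2 * S T ω) :
    IsStableHalfRandomBridge c T
      (fun x => ∫ z in Ioi 0, stableHalfBridgeDensity c T Tstar x z * p z) ξ₁ P ∧
    IsStableHalfRandomBridge c₂ T
      (fun x => (k ^ 2)⁻¹ *
        ∫ z in Ioi 0, stableHalfBridgeDensity c₂ T (lam⁻¹ * Tstar) x z * p ((k ^ 2)⁻¹ * z)) ξ₂ P ∧
    (Integrable (S Tstar) P →
      Integrable (ξ₁ T) P ∧ Integrable (ξ₂ T) P ∧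
      ∀ t : ℝ, 0 ≤ t → t < T →
        -- the conditional means given the two current values
        (∀ᵐ x ∂(P.map fun ω => (ξ₁ t ω, ξ₂ t ω)),
          condMeanGiven (ξ₁ T) (fun ω => (ξ₁ t ω, ξ₂ t ω)) P x =
              (T - t) / (Tstar - (1 + lam) * t) *
                (condMeanGiven (S Tstar) (S ((1 + lam) * t)) P (x.1 + (k ^ 2)⁻¹ * x.2)
                  - (k ^ 2)⁻¹ * x.2)
              + (Tstar - (T + lam * t)) / (Tstar - (1 + lam) * t) * x.1 ∧
          condMeanGiven (ξ₂ T) (fun ω => (ξ₁ t ω, ξ₂ t ω)) P x =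
              k ^ 2 * ((Tstar - (T + lam * t)) / (Tstar - (1 + lam) * t)) *
                (condMeanGiven (S Tstar) (S ((1 + lam) * t)) P (x.1 + (k ^ 2)⁻¹ * x.2) - x.1)
              + (T - t) / (Tstar - (1 + lam) * t) * x.2) ∧
        -- they are the best estimates given the whole history of both processes
        (P[ξ₁ T | jointHistory ξ₁ ξ₂ t] =ᵐ[P] fun ω =>
          condMeanGiven (ξ₁ T) (fun ω => (ξ₁ t ω, ξ₂ t ω)) P (ξ₁ t ω, ξ₂ t ω)) ∧
        (P[ξ₂ T | jointHistory ξ₁ ξ₂ t] =ᵐ[P] fun ω =>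
          condMeanGiven (ξ₂ T) (fun ω => (ξ₁ t ω, ξ₂ t ω)) P (ξ₁ t ω, ξ₂ t ω)) ∧
        -- the posterior mean as a one-dimensional integral, at almost every pair of values
        (∀ᵐ x ∂(P.map fun ω => (ξ₁ t ω, ξ₂ t ω)),
          ∫ z in Ioi 0, posteriorDensity c Tstar p ((1 + lam) * t) (x.1 + (k ^ 2)⁻¹ * x.2) z = 1 ∧
          IntegrableOn (fun z => z *
            posteriorDensity c Tstar p ((1 + lam) * t) (x.1 + (k ^ 2)⁻¹ * x.2) z) (Ioi 0) ∧
          condMeanGiven (S Tstar) (S ((1 + lam) * t)) P (x.1 + (k ^ 2)⁻¹ * x.2) =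
            ∫ z in Ioi 0, z *
              posteriorDensity c Tstar p ((1 + lam) * t) (x.1 + (k ^ 2)⁻¹ * x.2) z)) := by
  have hlam0 : 0 < lam := by
    rw [hlam, sub_pos, lt_div_iff₀ hT]
    linarith
  have hk0 : 0 < k := by rw [hk]; positivity
  have hTs : lam * T + T = Tstar := by
    rw [hlam]
    field_simp
    ring
  have hc₂k : k * (c * lam) = c₂ := by
    rw [hk]
    field_simp
  clear hlam hk
  lift T to ℝ≥0 using hT.le
  lift Tstar to ℝ≥0 using (hT.trans hTstar).le
  lift lam to ℝ≥0 using hlam0.le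
  rw [NNReal.coe_pos] at hT hlam0
  rw [NNReal.coe_lt_coe] at hTstar
  have hTs' : T + lam * T = Tstar := by
    rw [← NNReal.coe_inj]
    push_cast
    linarith
  have hτ : 0 < Tstar := hT.trans hTstar
  refine ⟨hS.initial hc hT hTstar hξ₁, ?_, fun hint => ?_⟩
  · have h := hS.shifted hc hT hk0 hlam0 hTs' hξ₂
    simpa only [hc₂k, integral_const_mul] using h
  have hmT : Measurable (S T) := hS.measurable_coe hTstar.le
  have hiT : Integrable (S T) P := hS.integrable hc hτ hint hTstar.le
  have e₁ : ξ₁ T = S T := funext fun ω => hξ₁ T ⟨T.coe_nonneg, le_rfl⟩ ω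
  have e₂ : ξ₂ T = fun ω => k ^ 2 * S Tstar ω - k ^ 2 * S T ω := funext fun ω => by
    rw [hξ₂ T ⟨T.coe_nonneg, le_rfl⟩ ω, hTs]
  have hi₂ : Integrable (ξ₂ T) P := by
    rw [e₂]
    exact (hint.const_mul _).sub (hiT.const_mul _)
  refine ⟨e₁ ▸ hiT, hi₂, fun t ht htT => ?_⟩
  lift t to ℝ≥0 using ht
  rw [NNReal.coe_lt_coe] at htT
  have hsτ : T + lam * t ≤ Tstar := by
    rw [← hTs']
    gcongr
  have hcu : ((t + lam * t : ℝ≥0) : ℝ) = (1 + lam) * t := by push_cast; ring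
  have e₁' : ∀ r : ℝ≥0, r ≤ T → ∀ ω, ξ₁ r ω = S r ω := fun r hr ω =>
    hξ₁ r ⟨r.coe_nonneg, NNReal.coe_le_coe.2 hr⟩ ω
  have e₂' : ∀ r : ℝ≥0, r ≤ T → ∀ ω, ξ₂ r ω = k ^ 2 * (S (T + lam * r : ℝ≥0) ω - S T ω) :=
    fun r hr ω => by
      rw [hξ₂ r ⟨r.coe_nonneg, NNReal.coe_le_coe.2 hr⟩ ω, mul_sub]
      congr 3
      push_cast
      ring
  have hm₁ : ∀ r : ℝ≥0, r ≤ T → Measurable (ξ₁ r) := fun r hr => by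
    rw [funext (e₁' r hr)]
    exact hS.measurable_coe (hr.trans hTstar.le)
  have hm₂ : ∀ r : ℝ≥0, r ≤ T → Measurable (ξ₂ r) := fun r hr => by
    rw [funext (e₂' r hr)]
    exact ((hS.measurable_coe (by rw [← hTs']; gcongr)).sub hmT).const_mul _
  have hFm : jointHistory ξ₁ ξ₂ t ≤ ‹MeasurableSpace Ω› := by
    refine iSup₂_le fun r hr => ?_
    lift r to ℝ≥0 using hr.1
    have hrT : r ≤ T := (NNReal.coe_le_coe.1 hr.2).trans htT.le
    exact sup_le (hm₁ r hrT).comap_le (hm₂ r hrT).comap_le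
  -- The history up to `t` is determined by the path on `[0, t]` and the increments on `[T, T + lam
  -- * t]`, that is, by the observation of `condExp_joint_history` with `s = lam * t`.
  have hFle : jointHistory ξ₁ ξ₂ t ≤ MeasurableSpace.comap (fun ω => (fun r : ℝ≥0 => S (min r t : ℝ≥0) ω,
      fun r : ℝ≥0 => S (T + min r (lam * t) : ℝ≥0) ω - S T ω)) inferInstance := by
    refine iSup₂_le fun r hr => ?_
    lift r to ℝ≥0 using hr.1
    have hrt : r ≤ t := NNReal.coe_le_coe.1 hr.2
    refine sup_le ?_ ?_
    · have h1 : ξ₁ r = (fun q : (ℝ≥0 → ℝ) × (ℝ≥0 → ℝ) => q.1 r) ∘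
          fun ω => (fun r : ℝ≥0 => S (min r t : ℝ≥0) ω,
            fun r : ℝ≥0 => S (T + min r (lam * t) : ℝ≥0) ω - S T ω) := by
        funext ω
        simp only [Function.comp_apply, min_eq_left hrt]
        exact e₁' r (hrt.trans htT.le) ω
      rw [h1]
      exact (Measurable.comp (by fun_prop) (comap_measurable _)).comap_le
    · have h1 : ξ₂ r = (fun q : (ℝ≥0 → ℝ) × (ℝ≥0 → ℝ) => k ^ 2 * q.2 (lam * r)) ∘
          fun ω => (fun r : ℝ≥0 => S (min r t : ℝ≥0) ω,
            fun r : ℝ≥0 => S (T + min r (lam * t) : ℝ≥0) ω - S T ω) := by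
        funext ω
        simp only [Function.comp_apply, min_eq_left (mul_le_mul_right hrt lam)]
        exact e₂' r (hrt.trans htT.le) ω
      rw [h1]
      exact (Measurable.comp (by fun_prop) (comap_measurable _)).comap_le
  have htmem : (t : ℝ) ∈ Icc (0 : ℝ) t := ⟨t.coe_nonneg, le_rfl⟩
  have hsup : MeasurableSpace.comap (ξ₁ t) inferInstance ⊔
      MeasurableSpace.comap (ξ₂ t) inferInstance ≤ jointHistory ξ₁ ξ₂ t :=
    le_iSup₂ (f := fun s (_ : s ∈ Icc (0 : ℝ) t) => MeasurableSpace.comap (ξ₁ s) inferInstance ⊔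
      MeasurableSpace.comap (ξ₂ s) inferInstance) (t : ℝ) htmem
  have hF₁ : Measurable[jointHistory ξ₁ ξ₂ t] (ξ₁ t) :=
    (comap_measurable _).mono (le_sup_left.trans hsup) le_rfl
  have hF₂ : Measurable[jointHistory ξ₁ ξ₂ t] (ξ₂ t) :=
    (comap_measurable _).mono (le_sup_right.trans hsup) le_rfl
  set X : Ω → ℝ × ℝ := fun ω => (ξ₁ t ω, ξ₂ t ω) with hX
  have hXF : Measurable[jointHistory ξ₁ ξ₂ t] X := hF₁.prodMk hF₂
  have hXm : Measurable X := hXF.mono hFm le_rfl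
  have hsum : Measurable fun x : ℝ × ℝ => x.1 + (k ^ 2)⁻¹ * x.2 := by fun_prop
  have hY : (fun ω => (X ω).1 + (k ^ 2)⁻¹ * (X ω).2) =
      fun ω => S t ω + (S (T + lam * t : ℝ≥0) ω - S T ω) := by
    funext ω
    simp only [hX, e₁' t htT.le, e₂' t htT.le]
    rw [inv_mul_cancel_left₀ (pow_ne_zero 2 hk0.ne')]
  have hYF : Measurable[jointHistory ξ₁ ξ₂ t] fun ω => (X ω).1 + (k ^ 2)⁻¹ * (X ω).2 := hsum.comp hXF
  obtain ⟨⟨hpm, hinc⟩, hae⟩ :=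
    hS.condExp_joint_history hc hint htT hsτ hY hFm hFle hYF
  have hmap : P.map (fun ω => (X ω).1 + (k ^ 2)⁻¹ * (X ω).2) =
      (P.map X).map fun x => x.1 + (k ^ 2)⁻¹ * x.2 :=
    (Measure.map_map hsum hXm).symm
  rw [hmap] at hae
  have hae' := ae_of_ae_map hsum.aemeasurable hae
  simp only [hcu] at hpm hae'
  have hden : (0 : ℝ) < Tstar - (1 + lam) * t := by
    have h1 : (t : ℝ) < T := htT
    have h2 : (0 : ℝ) < 1 + lam := by positivity
    nlinarith
  have hi₁t : Integrable (ξ₁ t) P := by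
    rw [funext (e₁' t htT.le)]
    exact hS.integrable hc hτ hint (htT.le.trans hTstar.le)
  have hiY : Integrable (fun ω => (X ω).1 + (k ^ 2)⁻¹ * (X ω).2) P := by
    rw [hY]
    exact (hS.integrable hc hτ hint (htT.le.trans hTstar.le)).add
      ((hS.integrable hc hτ hint hsτ).sub hiT)
  -- The known value `ξ₁ t` plus the first gap's share of the total expected remainder, which is the
  -- posterior mean minus `y`.
  have hc₁ : P[ξ₁ T | jointHistory ξ₁ ξ₂ t] =ᵐ[P] fun ω => ξ₁ t ω + ((T : ℝ) - t) / (Tstar - (1 + lam) * t) *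
      (posteriorMean c Tstar p ((1 + lam) * t) ((X ω).1 + (k ^ 2)⁻¹ * (X ω).2) -
        ((X ω).1 + (k ^ 2)⁻¹ * (X ω).2)) := by
    have h1 : ξ₁ T = ξ₁ t + fun ω => S T ω - S t ω := by
      funext ω
      simp only [Pi.add_apply, e₁, e₁' t htT.le]
      ring
    have hiS : Integrable (fun ω => S T ω - S t ω) P :=
      hiT.sub (hS.integrable hc hτ hint (htT.le.trans hTstar.le))
    have h2 := condExp_add hi₁t hiS (jointHistory ξ₁ ξ₂ t)
    have h3 := condExp_sub hint hiY (jointHistory ξ₁ ξ₂ t)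
    rw [condExp_of_stronglyMeasurable hFm hF₁.stronglyMeasurable hi₁t] at h2
    rw [condExp_of_stronglyMeasurable hFm hYF.stronglyMeasurable hiY] at h3
    rw [h1]
    filter_upwards [h2, h3, hpm, hinc] with ω h4 h5 h6 h7
    simp only [Pi.add_apply, Pi.sub_apply] at h4 h5
    have h8 : ((Tstar : ℝ) - (t + (lam * t : ℝ≥0))) = Tstar - (1 + lam) * t := by
      push_cast
      ring
    rw [h4, h7, h8, ← h6, ← h5]
    rfl
  have hc₂' : P[ξ₂ T | jointHistory ξ₁ ξ₂ t] =ᵐ[P] fun ω =>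
      k ^ 2 * (posteriorMean c Tstar p ((1 + lam) * t) ((X ω).1 + (k ^ 2)⁻¹ * (X ω).2) - P[ξ₁ T | jointHistory ξ₁ ξ₂ t] ω) := by
    have h1 : ξ₂ T = (k ^ 2) • (S Tstar - ξ₁ T) := by
      funext ω
      simp only [e₁, e₂, Pi.smul_apply, Pi.sub_apply, smul_eq_mul]
      ring
    rw [h1]
    filter_upwards [condExp_smul (k ^ 2) (S Tstar - ξ₁ T) (jointHistory ξ₁ ξ₂ t) (μ := P),
      condExp_sub hint (e₁ ▸ hiT : Integrable (ξ₁ T) P) (jointHistory ξ₁ ξ₂ t), hpm] with ω h2 h3 h4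
    rw [h2, Pi.smul_apply, h3, Pi.sub_apply, h4, smul_eq_mul]
  set pm : ℝ → ℝ := posteriorMean c Tstar p ((1 + lam) * t) with hpmdef
  have hpmm : Measurable pm := measurable_posteriorMean c Tstar _ hS.density_measurable
  have hpmX : Measurable fun x : ℝ × ℝ => pm (x.1 + (k ^ 2)⁻¹ * x.2) := hpmm.comp hsum
  obtain ⟨hu₁, hv₁⟩ := condMeanGiven_ae_eq (Z := ξ₁ T) hXm (e₁ ▸ hiT)
    (g := fun x => x.1 + ((T : ℝ) - t) / (Tstar - (1 + lam) * t) *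
      (pm (x.1 + (k ^ 2)⁻¹ * x.2) - (x.1 + (k ^ 2)⁻¹ * x.2))) (by fun_prop)
    hXF.comap_le hFm hc₁
  obtain ⟨hu₂, hv₂⟩ := condMeanGiven_ae_eq (Z := ξ₂ T) hXm hi₂
    (g := fun x => k ^ 2 * (pm (x.1 + (k ^ 2)⁻¹ * x.2) -
      (x.1 + ((T : ℝ) - t) / (Tstar - (1 + lam) * t) *
        (pm (x.1 + (k ^ 2)⁻¹ * x.2) - (x.1 + (k ^ 2)⁻¹ * x.2))))) (by fun_prop)
    hXF.comap_le hFm (by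
      filter_upwards [hc₁, hc₂'] with ω h1 h2
      rw [h2, h1])
  refine ⟨?_, hv₁, hv₂, ?_⟩
  · filter_upwards [hu₁, hu₂, hae'] with x h1 h2 h3
    -- The shares of the two gaps add up to `1`; what remains is algebra in a single share `r`.
    have hr : ((Tstar : ℝ) - (T + lam * t)) / (Tstar - (1 + lam) * t) =
        1 - ((T : ℝ) - t) / (Tstar - (1 + lam) * t) := by
      rw [eq_sub_iff_add_eq, ← add_div, div_eq_one_iff_eq hden.ne']
      ring
    rw [h1, h2, h3.2, hr]
    generalize pm (x.1 + (k ^ 2)⁻¹ * x.2) = q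
    generalize ((T : ℝ) - t) / (Tstar - (1 + lam) * t) = r
    exact ⟨by ring, by field_simp; ring⟩
  · filter_upwards [hae'] with x h3
    exact ⟨h3.1.1, h3.1.2, h3.2⟩
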